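/- Let $p\ge 0$ and let $H(D)=\sum_{k=0}^{p}h_kD^k$ be a real FIR channel with $H(e^{j\omega})\neq 0$ for all $\omega$. For a nonzero polynomial $I(D)$ with integer coefficients (of arbitrary finite length) let $$\sigma^2(I)=\frac1{2\pi}\int_{-\pi}^{\pi}\frac{|I(e^{j\omega})|^2}{|H(e^{j\omega})|^2}\,d\omega$$ be the power of unit-power white noise at the output of the filter $I(D)/H(D)$, and let $$\sigma^2_{\text{ZF-DFE}}=\exp\Big[-\frac1{2\pi}\int_{-\pi}^{\pi}\log|H(e^{j\omega})|^2\,d\omega\Big].$$ Let $z_\mu$ be the maximum-phase zeros of $H(D)H^*(D^{-*})$, i.e. its zeros outside the unit circle, counted with multiplicity ($H^*(D^{-*})=\sum_k \overline{h_k}D^{-k}$; there are exactly $p$ of them, $z_0,\dots,z_{p-1}$, when $h_0h_p\ne0$), and put $$\alpha_H=\frac{\big|\prod_{\mu}z_\mu\big|^{2p}}{\prod_{\mu,\nu}|\overline{z_\mu}z_\nu-1|},\qquad \eta(n)=\frac{2n}{\pi e}\,(1.4\,\pi n)^{1/n}.$$ Then there is an optimal integer filter, i.e. a nonzero $I(D)\in\mathbb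 Z[D]$ minimizing $\sigma^2(I)$ among all nonzero integer polynomials; the minimum of $\eta(n)\,\alpha_H^{1/n}$ over the integers $n\ge p+1$ is attained; and for every optimal $I(D)$ the noise power $\sigma^2_{\text{ZF-IF-DFE}}=\sigma^2(I)$ satisfies $$\sigma^2_{\text{ZF-IF-DFE}}\le\sigma^2_{\text{ZF-DFE}}\cdot\min_{n\ge p+1}\big[\eta(n)\,\alpha_H^{1/n}\big].$$ For complex $h_0,\dots,h_p$ and filters $I(D)$ with Gaussian-integer coefficients the same holds with $\eta(n)=\frac{4n}{\pi e}(2.8\,\pi n)^{1/(2n)}$. -/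

import Mathlib

open Polynomial

noncomputable section

namespace IFEqualization

/-- The channel `H(D) = ∑_{k=0}^p h_k D^k`. -/
def channel {p : ℕ} (h : Fin (p + 1) → ℂ) : ℂ[X] :=
  ∑ k : Fin (p + 1), C (h k) * X ^ (k : ℕ)

/-- The polynomial `D^p H*(D^{-*}) = ∑_{k=0}^p conj(h_k) D^{p-k}`. -/
def conjReverse {p : ℕ} (h : Fin (p + 1) → ℂ) : ℂ[X] :=
  ∑ k : Fin (p + 1), C (star (h k)) * X ^ (p - (k : ℕ))

open Classical in
/-- The maximum-phase zeros of `H(D) H*(D^{-*})`, that is, its zeros outside the closed unit disc,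
listed with multiplicity. The factor `D^p` that turns `H(D) H*(D^{-*})` into a polynomial only
affects the point `0`. -/
def maxPhaseZeros {p : ℕ} (h : Fin (p + 1) → ℂ) : Multiset ℂ :=
  (channel h * conjReverse h).roots.filter (fun z => 1 < ‖z‖)

/-- `α_H = |z_0 ⋯ z_{p-1}|^{2p} / ∏_{μ,ν} |z_μ^* z_ν - 1|`, the `z_μ` being the maximum-phase
zeros. -/
def alpha {p : ℕ} (h : Fin (p + 1) → ℂ) : ℝ :=
  ‖(maxPhaseZeros h).prod‖ ^ (2 * p) /
    ((maxPhaseZeros h).map fun z =>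
      ((maxPhaseZeros h).map fun w => ‖star z * w - 1‖).prod).prod

/-- `η(n) = (2n / (π e)) (1.4 π n)^{1/n}` (real channels). -/
def etaReal (n : ℕ) : ℝ :=
  2 * n / (Real.pi * Real.exp 1) * (1.4 * Real.pi * n) ^ (1 / (n : ℝ))

/-- `η(n) = (4n / (π e)) (2.8 π n)^{1/(2n)}` (complex channels). -/
def etaComplex (n : ℕ) : ℝ :=
  4 * n / (Real.pi * Real.exp 1) * (2.8 * Real.pi * n) ^ (1 / (2 * (n : ℝ)))

/-- The point `e^{jω}` of the unit circle. -/
def expj (ω : ℝ) : ℂ := Complex.exp (ω * Complex.I)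

/-- The power `(1/2π) ∫_{-π}^{π} |I(e^{jω})|² / |H(e^{jω})|² dω` of white noise of unit power
after the filter `I(D)/H(D)`. -/
def noisePower (I H : ℂ[X]) : ℝ :=
  1 / (2 * Real.pi) *
    ∫ ω in (-Real.pi)..Real.pi, ‖I.eval (expj ω)‖ ^ 2 / ‖H.eval (expj ω)‖ ^ 2

/-- `σ²_{ZF-DFE} = exp (-(1/2π) ∫_{-π}^{π} log |H(e^{jω})|² dω)`. -/
def dfeNoisePower (H : ℂ[X]) : ℝ :=
  Real.exp (-(1 / (2 * Real.pi) *
    ∫ ω in (-Real.pi)..Real.pi, Real.log (‖H.eval (expj ω)‖ ^ 2)))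

/-- `I(D)` is an optimal integer filter for `H(D)`: it minimizes the noise power at the output of
`I(D)/H(D)` among all nonzero finite-length filters whose coefficients lie in the ring `R` of
integers (`φ` is the inclusion of `R = ℤ` or `R = ℤ[i]` in `ℂ`). -/
def IsOptimalFilter {R : Type} [CommRing R] (φ : R →+* ℂ) (H : ℂ[X]) (I : R[X]) : Prop :=
  I ≠ 0 ∧ ∀ J : R[X], J ≠ 0 → noisePower (I.map φ) H ≤ noisePower (J.map φ) H

end IFEqualization

end

/-!
The noise power of a filter with at most `n` coefficients is a quadratic form in them, whose
Gram matrix is the Toeplitz matrix of the spectrum `1 / |H|²`. Minkowski's convex body theorem,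
with Stirling's bound for the volume of the ball, gives a nonzero integer vector at which the form
is at most `η(n) det^{1/n}` (`exists_int_ne_zero_sum_sq_le`); Hermitian forms are real forms in
twice as many variables. An optimal filter can only be better, so the bound follows for every
`n ≥ p + 1` from `det ≤ σ^{2n} α_H` (`alpha_pos_and_det_bound`).

On the unit circle `|H| = K ∏ |D - z|`, with `z` running over the maximum-phase zeros. Jensen's
formula gives `σ² = (K ∏ |z|)⁻²`, and the determinant is computed by induction on the number of
zeros (`det_gramMatrix_cons`). For a zero `w` and the remaining zeros `v`, the multiples of `D - w`
form a copy of the space of polynomials of degree one less for the spectrum without `w`, and their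
orthogonal complement is spanned by a power of `D` times `∏ (1 - conj(v) D)`. This element has
squared norm `1 / (|w|² - 1)`, and its value at `w` is the determinant of the change of basis.

The lengths of the filters are not bounded in the definition of optimality, so the existence of a
minimum needs an argument: a filter with a long gap costs almost as much as two separate filters,
by the Riemann–Lebesgue lemma, and up to delay only finitely many cheap filters have no long gap
(`exists_isOptimalFilter`). The minimum over `n` is attained because `η(n)` grows linearly.
-/

namespace IFEqualization

open Real (circleAverage)
open ComplexConjugate Filter Topology

/-! ### Minkowski's theorem for ellipsoids -/

/-- The ratio of `Γ(x + 1)²` to its Stirling approximation `(x / e)^{2x} x` does not increase when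
`x` is replaced by `x + 1`; this is `log (1 + 1 / x) ≥ 2 / (2x + 1)`. -/
theorem gamma_add_one_sq_mul_stirling_le (x : ℝ) (hx : 0 < x) :
    Real.Gamma (x + 1 + 1) ^ 2 * ((x / Real.exp 1) ^ (2 * x) * x) ≤
      Real.Gamma (x + 1) ^ 2 * (((x + 1) / Real.exp 1) ^ (2 * (x + 1)) * (x + 1)) := by
  have hx1 : 0 < x + 1 := by linarith
  rw [Real.Gamma_add_one hx1.ne', mul_pow]
  have key : Real.exp 2 * x ^ (2 * x + 1) ≤ (x + 1) ^ (2 * x + 1) := by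
    rw [Real.rpow_def_of_pos hx, Real.rpow_def_of_pos hx1, ← Real.exp_add, Real.exp_le_exp]
    have h := Real.le_log_one_add_of_nonneg (x := 1 / x) (by positivity)
    have h1 : Real.log (1 + 1 / x) = Real.log (x + 1) - Real.log x := by
      rw [← Real.log_div hx1.ne' hx.ne']; congr 1; field_simp
    rw [h1] at h
    have h2 : 2 * (1 / x) / (1 / x + 2) = 2 / (2 * x + 1) := by field_simp; ring
    rw [h2, div_le_iff₀ (by positivity)] at h
    linarith
  have e1 : (x / Real.exp 1) ^ (2 * x) * x = x ^ (2 * x + 1) / Real.exp (2 * x) := by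
    rw [Real.div_rpow hx.le (Real.exp_pos _).le, Real.rpow_add_one hx.ne', ← Real.exp_mul, one_mul]
    ring
  have e2 : ((x + 1) / Real.exp 1) ^ (2 * (x + 1)) * (x + 1) =
      (x + 1) ^ (2 * x + 1) * (x + 1) ^ 2 / (Real.exp 2 * Real.exp (2 * x)) := by
    rw [Real.div_rpow hx1.le (Real.exp_pos _).le, ← Real.exp_mul, one_mul, ← Real.exp_add,
      ← Real.rpow_add_natCast hx1.ne', div_mul_eq_mul_div, ← Real.rpow_add_one hx1.ne']
    congr 2 <;> push_cast <;> ring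
  rw [e1, e2]
  have hE : (0:ℝ) < Real.exp 2 := Real.exp_pos _
  have hF : (0:ℝ) < Real.exp (2 * x) := Real.exp_pos _
  have e3 : x ^ (2 * x + 1) ≤ (x + 1) ^ (2 * x + 1) / Real.exp 2 := by
    rw [le_div_iff₀ hE]; linarith
  calc (x + 1) ^ 2 * Real.Gamma (x + 1) ^ 2 * (x ^ (2 * x + 1) / Real.exp (2 * x))
      ≤ (x + 1) ^ 2 * Real.Gamma (x + 1) ^ 2 *
          (((x + 1) ^ (2 * x + 1) / Real.exp 2) / Real.exp (2 * x)) := by gcongr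
    _ = _ := by field_simp

/-- By `gamma_add_one_sq_mul_stirling_le` the ratio of the two sides is largest, for odd and even
`N`, at `N = 1` and `N = 2`, where the claim is `e ≤ 2.8` and `e² ≤ 2.8 π`. The first of these is
what the constant `1.4` in `η` is made for. -/
theorem gamma_sq_le_stirling (N : ℕ) (hN : 1 ≤ N) :
    Real.Gamma ((N : ℝ) / 2 + 1) ^ 2 ≤
      2.8 * Real.pi * (((N : ℝ) / 2 / Real.exp 1) ^ (2 * ((N : ℝ) / 2)) * ((N : ℝ) / 2)) := by
  have he := Real.exp_one_lt_d9
  have hp := Real.pi_gt_d2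
  induction N using Nat.twoStepInduction with
  | zero => omega
  | one =>
    have : Real.Gamma ((1 : ℝ) / 2 + 1) = 1 / 2 * √Real.pi := by
      rw [Real.Gamma_add_one (by norm_num), Real.Gamma_one_half_eq]
    push_cast
    rw [this, mul_pow, Real.sq_sqrt Real.pi_pos.le]
    norm_num
    have h1 : 1 / 4 ≤ 14 / 5 * (1 / (2 * Real.exp 1) * (1 / 2)) := by
      rw [div_mul_div_comm, mul_div_assoc', le_div_iff₀ (by positivity)]
      linarith
    have := mul_le_mul_of_nonneg_right h1 Real.pi_pos.le
    rw [div_div]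
    linarith
  | more n ih1 ih2 =>
    rcases Nat.eq_zero_or_pos n with rfl | hn
    · norm_num
      have h3 : Real.exp 2 ≤ 2.7182818286 ^ 2 := by
        have h4 : Real.exp 2 = Real.exp 1 ^ 2 := by rw [← Real.exp_nat_mul]; norm_num
        rw [h4]
        exact pow_le_pow_left₀ (Real.exp_pos _).le he.le 2
      rw [← div_eq_mul_inv, le_div_iff₀ (Real.exp_pos _)]
      norm_num at h3
      linarith
    · have h := ih1 hn
      have hs := gamma_add_one_sq_mul_stirling_le ((n : ℝ) / 2) (by positivity)
      have c1 : ((n + 2 : ℕ) : ℝ) / 2 = (n : ℝ) / 2 + 1 := by push_cast; ring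
      rw [c1]
      set x : ℝ := (n : ℝ) / 2
      have hx : 0 < x := by positivity
      have hu : 0 < (x / Real.exp 1) ^ (2 * x) * x := by positivity
      refine le_of_mul_le_mul_right (hs.trans ?_) hu
      have hv : 0 ≤ ((x + 1) / Real.exp 1) ^ (2 * (x + 1)) * (x + 1) := by positivity
      nlinarith [mul_le_mul_of_nonneg_right h hv]

theorem gamma_sq_le {N : ℕ} (hN : 1 ≤ N) :
    Real.Gamma ((N : ℝ) / 2 + 1) ^ 2 ≤
      ((N : ℝ) / (2 * Real.exp 1)) ^ N * (1.4 * Real.pi * N) := by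
  refine (gamma_sq_le_stirling N hN).trans_eq ?_
  rw [show 2 * ((N : ℝ) / 2) = N by ring, Real.rpow_natCast, div_div]
  ring

theorem etaReal_pos {N : ℕ} (hN : 1 ≤ N) : 0 < etaReal N := by
  have : (0 : ℝ) < N := by exact_mod_cast hN
  have := Real.pi_pos
  unfold etaReal
  positivity

theorem etaReal_pow {N : ℕ} (hN : 1 ≤ N) :
    etaReal N ^ N = (2 * N / (Real.pi * Real.exp 1)) ^ N * (1.4 * Real.pi * N) := by
  have h0 : (0 : ℝ) < N := by exact_mod_cast hN
  have := Real.pi_pos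
  unfold etaReal
  rw [mul_pow, ← Real.rpow_natCast ((1.4 * Real.pi * N) ^ (1 / (N : ℝ))),
    ← Real.rpow_mul (by positivity),
    one_div, inv_mul_cancel₀ h0.ne', Real.rpow_one]

open MeasureTheory in
/-- The volume of the ellipsoid `‖M x‖ ≤ r`. It is written with real powers, the form in which
Mathlib states the volume of Euclidean balls in `ι → ℝ`. -/
theorem volume_ellipsoid {ι : Type*} [Fintype ι] [DecidableEq ι] [Nonempty ι]
    (M : Matrix ι ι ℝ) (hM : M.det ≠ 0) (r : ℝ) :
    volume {x : ι → ℝ | (∑ i, |M.mulVec x i| ^ (2 : ℝ)) ^ (1 / (2 : ℝ)) ≤ r} =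
      ENNReal.ofReal |M.det⁻¹| * (ENNReal.ofReal r ^ Fintype.card ι *
        ENNReal.ofReal (√Real.pi ^ Fintype.card ι /
          Real.Gamma ((Fintype.card ι : ℝ) / 2 + 1))) := by
  have h := MeasureTheory.volume_sum_rpow_le ι (p := 2) (by norm_num) r
  have hd : LinearMap.det (Matrix.toLin' M) ≠ 0 := by rwa [LinearMap.det_toLin']
  have h2 := Measure.addHaar_preimage_linearMap (volume : Measure (ι → ℝ)) hd
    {x : ι → ℝ | (∑ i, |x i| ^ (2 : ℝ)) ^ (1 / (2 : ℝ)) ≤ r}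
  rw [h, LinearMap.det_toLin'] at h2
  have hg : 2 * Real.Gamma (1 / 2 + 1) = √Real.pi := by
    rw [Real.Gamma_add_one (by norm_num), Real.Gamma_one_half_eq]; ring
  rw [hg] at h2
  exact h2

open MeasureTheory in
/-- Minkowski's bound for the minimum of the quadratic form `‖M x‖²` over nonzero integer vectors,
with `etaReal` as an upper bound for Hermite's constant. -/
theorem exists_int_ne_zero_sum_sq_le {ι : Type*} [Fintype ι] [DecidableEq ι] [Nonempty ι]
    (M : Matrix ι ι ℝ) (hM : M.det ≠ 0) :
    ∃ x : ι → ℤ, x ≠ 0 ∧ ∑ i, (M.mulVec (fun i => (x i : ℝ)) i) ^ 2 ≤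
      etaReal (Fintype.card ι) * (M.det ^ 2) ^ (1 / (Fintype.card ι : ℝ)) := by
  set N := Fintype.card ι with hNdef
  have hN : 1 ≤ N := Fintype.card_pos
  have hN0 : (0 : ℝ) < N := by exact_mod_cast hN
  set R := etaReal N * (M.det ^ 2) ^ (1 / (N : ℝ)) with hR
  have hRpos : 0 < R := mul_pos (etaReal_pos hN) (by positivity)
  have hRN : R ^ N = etaReal N ^ N * M.det ^ 2 := by
    rw [hR, mul_pow, ← Real.rpow_natCast ((M.det ^ 2) ^ (1 / (N : ℝ))),
      ← Real.rpow_mul (by positivity), one_div, inv_mul_cancel₀ hN0.ne', Real.rpow_one]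
  set s := {x : ι → ℝ | (∑ i, |M.mulVec x i| ^ (2 : ℝ)) ^ (1 / (2 : ℝ)) ≤ √R} with hs
  have mem_s (x : ι → ℝ) : x ∈ s ↔ ∑ i, (M.mulVec x i) ^ 2 ≤ R := by
    simp only [hs, Set.mem_ofPred_eq, Real.rpow_two, sq_abs, ← Real.sqrt_eq_rpow]
    exact Real.sqrt_le_sqrt_iff hRpos.le
  have hcont : Continuous fun x : ι → ℝ => M.mulVec x := by fun_prop
  have hclosed : IsClosed s := by
    have : s = {x | ∑ i, (M.mulVec x i) ^ 2 ≤ R} := by ext x; exact mem_s x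
    rw [this]
    refine isClosed_le ?_ continuous_const
    exact continuous_finsetSum _ fun i _ => ((continuous_apply i).comp hcont).pow 2
  have hunit : IsUnit M.det := isUnit_iff_ne_zero.mpr hM
  have hcpt : IsCompact s := by
    have hsub : s ⊆ (fun y => M⁻¹.mulVec y) '' (Metric.closedBall (0 : ι → ℝ) (√R)) := by
      intro x hx
      refine ⟨M.mulVec x, ?_, ?_⟩
      · rw [mem_closedBall_zero_iff, pi_norm_le_iff_of_nonneg (Real.sqrt_nonneg _)]
        intro i
        refine Real.le_sqrt_of_sq_le ?_
        rw [Real.norm_eq_abs, sq_abs]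
        exact (Finset.single_le_sum (f := fun i => (M.mulVec x i) ^ 2)
          (fun _ _ => sq_nonneg _) (Finset.mem_univ i)).trans ((mem_s x).1 hx)
      · simp [Matrix.mulVec_mulVec, Matrix.nonsing_inv_mul _ hunit]
    refine IsCompact.of_isClosed_subset ?_ hclosed hsub
    exact (isCompact_closedBall _ _).image (by fun_prop)
  have hsymm : ∀ x ∈ s, -x ∈ s := by
    intro x hx
    rw [mem_s] at hx ⊢
    simpa [Matrix.mulVec_neg] using hx
  have hconv : Convex ℝ s := by
    intro x hx y hy a b ha hb hab
    rw [mem_s] at hx hy ⊢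
    have h1 : ∑ i, (M.mulVec (a • x + b • y) i) ^ 2 ≤
        ∑ i, (a * (M.mulVec x i) ^ 2 + b * (M.mulVec y i) ^ 2) := by
      refine Finset.sum_le_sum fun i _ => ?_
      rw [Matrix.mulVec_add, Matrix.mulVec_smul, Matrix.mulVec_smul]
      exact (even_two.convexOn_pow (𝕜 := ℝ)).2 (Set.mem_univ _) (Set.mem_univ _) ha hb hab
    rw [Finset.sum_add_distrib, ← Finset.mul_sum, ← Finset.mul_sum] at h1
    have h2 := mul_le_mul_of_nonneg_left hx ha
    have h3 := mul_le_mul_of_nonneg_left hy hb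
    have h4 : a * R + b * R = R := by rw [← add_mul, hab, one_mul]
    linarith
  let b := Pi.basisFun ℝ ι
  have hfund := ZSpan.isAddFundamentalDomain' b (volume : Measure (ι → ℝ))
  have hvolF : volume (ZSpan.fundamentalDomain b) = 1 := by
    rw [ZSpan.fundamentalDomain_pi_basisFun, Real.volume_pi_Ico]
    simp
  have hvol : volume (ZSpan.fundamentalDomain b) * 2 ^ Module.finrank ℝ (ι → ℝ) ≤ volume s := by
    rw [hvolF, one_mul, Module.finrank_fintype_fun_eq_card, hs, volume_ellipsoid M hM,
      ← hNdef, ← ENNReal.ofReal_pow (Real.sqrt_nonneg _),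
      ← ENNReal.ofReal_mul (by positivity), ← ENNReal.ofReal_mul (by positivity),
      show (2 : ENNReal) ^ N = ENNReal.ofReal (2 ^ N) by
        rw [ENNReal.ofReal_pow (by norm_num)]; simp]
    refine ENNReal.ofReal_le_ofReal ?_
    have hG : 0 < Real.Gamma ((N : ℝ) / 2 + 1) := Real.Gamma_pos_of_pos (by positivity)
    have hdet : 0 < |M.det| := abs_pos.mpr hM
    rw [abs_inv, inv_mul_eq_div, le_div_iff₀ hdet, mul_div_assoc', le_div_iff₀ hG]
    refine le_of_sq_le_sq ?_ (by positivity)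
    rw [mul_pow, mul_pow, mul_pow, sq_abs, ← pow_mul (√R), mul_comm N 2, pow_mul (√R),
      Real.sq_sqrt hRpos.le, ← pow_mul (√Real.pi), mul_comm N 2, pow_mul (√Real.pi),
      Real.sq_sqrt Real.pi_pos.le, hRN, etaReal_pow hN]
    have hg := gamma_sq_le hN
    have hpi := Real.pi_pos
    calc ((2 : ℝ) ^ N) ^ 2 * M.det ^ 2 * Real.Gamma ((N : ℝ) / 2 + 1) ^ 2
        ≤ ((2 : ℝ) ^ N) ^ 2 * M.det ^ 2 *
          (((N : ℝ) / (2 * Real.exp 1)) ^ N * (1.4 * Real.pi * N)) := by gcongr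
      _ = _ := by
        have : (2 * (N : ℝ) / (Real.pi * Real.exp 1)) ^ N * Real.pi ^ N =
            ((2 : ℝ) ^ N) ^ 2 * ((N : ℝ) / (2 * Real.exp 1)) ^ N := by
          rw [← mul_pow, ← pow_mul, mul_comm N 2, pow_mul, ← mul_pow]
          congr 1
          field_simp
        linear_combination (-(M.det ^ 2 * (1.4 * Real.pi * N))) * this
  have : Countable (Submodule.span ℤ (Set.range b)).toAddSubgroup :=
    inferInstanceAs (Countable (Submodule.span ℤ (Set.range b)))
  have : DiscreteTopology (Submodule.span ℤ (Set.range b)).toAddSubgroup :=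
    inferInstanceAs (DiscreteTopology (Submodule.span ℤ (Set.range b)))
  obtain ⟨x, hx0, hxs⟩ := exists_ne_zero_mem_lattice_of_measure_mul_two_pow_le_measure
    (μ := (volume : Measure (ι → ℝ))) hfund hsymm hconv hcpt hvol
  have hmem : (x : ι → ℝ) ∈ Submodule.span ℤ (Set.range b) := x.2
  rw [Module.Basis.mem_span_iff_repr_mem] at hmem
  choose y hy using hmem
  have hyx : (fun i => (y i : ℝ)) = (x : ι → ℝ) := by
    funext i
    simpa [b] using hy i
  refine ⟨y, ?_, ?_⟩
  · rintro rfl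
    apply hx0
    ext i
    simp [← hyx]
  · rw [hyx]
    exact (mem_s _).1 hxs

/-! ### The weighted inner product on the unit circle -/

/-- The inner product `(1/2π) ∫ conj(f) g / |H|² dω` of two polynomials on the unit circle,
antilinear in `f`. With `f = g` it is the noise power at the output of `f / H`
(`weightedInner_self`). -/
noncomputable def weightedInner (H f g : ℂ[X]) : ℂ :=
  circleAverage (fun z => conj (f.eval z) * g.eval z / (‖H.eval z‖ ^ 2 : ℝ)) 0 1

theorem circleIntegrable_weighted {H : ℂ[X]} (hH : ∀ z : ℂ, ‖z‖ = 1 → H.eval z ≠ 0)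
    (f g : ℂ[X]) :
    CircleIntegrable (fun z => conj (f.eval z) * g.eval z / (‖H.eval z‖ ^ 2 : ℝ)) 0 1 := by
  refine ContinuousOn.circleIntegrable' ?_
  refine ContinuousOn.div (by fun_prop) (by fun_prop) ?_
  intro z hz
  have : ‖z‖ = 1 := by simpa using hz
  simpa using hH z this

theorem weightedInner_congr {H H' f f' g g' : ℂ[X]}
    (h : ∀ z : ℂ, ‖z‖ = 1 → conj (f.eval z) * g.eval z / (‖H.eval z‖ ^ 2 : ℝ) =
      conj (f'.eval z) * g'.eval z / (‖H'.eval z‖ ^ 2 : ℝ)) :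
    weightedInner H f g = weightedInner H' f' g' := by
  refine Real.circleAverage_congr_sphere fun z hz => h z ?_
  simpa using hz

theorem conj_circleAverage (f : ℂ → ℂ) :
    conj (circleAverage f 0 1) = circleAverage (fun z => conj (f z)) 0 1 := by
  simp only [Real.circleAverage, Complex.real_smul, map_mul, Complex.conj_ofReal]
  rw [intervalIntegral.intervalIntegral_conj]

theorem weightedInner_conj (H f g : ℂ[X]) :
    conj (weightedInner H f g) = weightedInner H g f := by
  unfold weightedInner
  rw [conj_circleAverage]
  congr 1
  funext z
  simp only [map_div₀, map_mul, Complex.conj_conj, Complex.conj_ofReal]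
  ring

theorem weightedInner_add_right {H : ℂ[X]} (hH : ∀ z : ℂ, ‖z‖ = 1 → H.eval z ≠ 0)
    (f g g' : ℂ[X]) :
    weightedInner H f (g + g') = weightedInner H f g + weightedInner H f g' := by
  unfold weightedInner
  rw [← Real.circleAverage_fun_add (circleIntegrable_weighted hH f g)
    (circleIntegrable_weighted hH f g')]
  congr 1
  funext z
  rw [eval_add]
  ring

theorem weightedInner_C_mul_right (H f g : ℂ[X]) (a : ℂ) :
    weightedInner H f (C a * g) = a * weightedInner H f g := by
  unfold weightedInner
  rw [← smul_eq_mul a (circleAverage _ 0 1), ← Real.circleAverage_fun_smul]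
  congr 1
  funext z
  rw [eval_mul, eval_C, smul_eq_mul]
  ring

theorem weightedInner_add_left {H : ℂ[X]} (hH : ∀ z : ℂ, ‖z‖ = 1 → H.eval z ≠ 0)
    (f f' g : ℂ[X]) :
    weightedInner H (f + f') g = weightedInner H f g + weightedInner H f' g := by
  rw [← weightedInner_conj, weightedInner_add_right hH, map_add, weightedInner_conj,
    weightedInner_conj]

theorem weightedInner_sum_right {H : ℂ[X]} (hH : ∀ z : ℂ, ‖z‖ = 1 → H.eval z ≠ 0)
    {ι : Type*} (s : Finset ι) (f : ℂ[X]) (a : ι → ℂ) (g : ι → ℂ[X]) :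
    weightedInner H f (∑ i ∈ s, C (a i) * g i) = ∑ i ∈ s, a i * weightedInner H f (g i) := by
  classical
  induction s using Finset.induction_on with
  | empty => simp [weightedInner, Real.circleAverage]
  | insert i s hi ih =>
    rw [Finset.sum_insert hi, Finset.sum_insert hi, weightedInner_add_right hH, ih,
      weightedInner_C_mul_right]

theorem weightedInner_sum_left {H : ℂ[X]} (hH : ∀ z : ℂ, ‖z‖ = 1 → H.eval z ≠ 0)
    {ι : Type*} (s : Finset ι) (f : ℂ[X]) (a : ι → ℂ) (g : ι → ℂ[X]) :
    weightedInner H (∑ i ∈ s, C (a i) * g i) f = ∑ i ∈ s, conj (a i) * weightedInner H (g i) f := by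
  rw [← weightedInner_conj, weightedInner_sum_right hH, map_sum]
  exact Finset.sum_congr rfl fun i _ => by rw [map_mul, weightedInner_conj]

/-- The Gram matrix of `1, D, …, D^{n-1}` for `weightedInner H`. It is the Toeplitz matrix of the
spectrum `1 / |H|²`. -/
noncomputable def gramMatrix (n : ℕ) (H : ℂ[X]) : Matrix (Fin n) (Fin n) ℂ :=
  Matrix.of fun i j => weightedInner H (X ^ (i : ℕ)) (X ^ (j : ℕ))

theorem weightedInner_eq_sum {H : ℂ[X]} (hH : ∀ z : ℂ, ‖z‖ = 1 → H.eval z ≠ 0) {n : ℕ}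
    {f g : ℂ[X]} (hf : f.natDegree < n) (hg : g.natDegree < n) :
    weightedInner H f g =
      ∑ i : Fin n, ∑ j : Fin n, conj (f.coeff i) * gramMatrix n H i j * g.coeff j := by
  have e (f : ℂ[X]) (hf : f.natDegree < n) : f = ∑ i : Fin n, C (f.coeff i) * X ^ (i : ℕ) := by
    rw [Fin.sum_univ_eq_sum_range (fun i => C (f.coeff i) * X ^ i)]
    exact f.as_sum_range_C_mul_X_pow' hf
  conv_lhs => rw [e f hf, e g hg]
  rw [weightedInner_sum_left hH]
  refine Finset.sum_congr rfl fun i _ => ?_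
  rw [weightedInner_sum_right hH, Finset.mul_sum]
  refine Finset.sum_congr rfl fun j _ => ?_
  simp only [gramMatrix, Matrix.of_apply]
  ring

theorem gramMatrix_isHermitian (n : ℕ) (H : ℂ[X]) : (gramMatrix n H).IsHermitian := by
  ext i j
  simp only [Matrix.conjTranspose_apply, gramMatrix, Matrix.of_apply]
  exact weightedInner_conj _ _ _

theorem circleAverage_expj {E : Type*} [NormedAddCommGroup E] [NormedSpace ℝ E] (f : ℂ → E) :
    circleAverage f 0 1 = (1 / (2 * Real.pi)) • ∫ ω in (-Real.pi)..Real.pi, f (expj ω) := by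
  have h : (fun θ => f (circleMap 0 1 θ)).Periodic (2 * Real.pi) := fun x => by
    simp [periodic_circleMap 0 1 x]
  have h2 := h.intervalIntegral_add_eq 0 (-Real.pi)
  rw [Real.circleAverage_def, one_div]
  rw [zero_add, show -Real.pi + 2 * Real.pi = Real.pi by ring] at h2
  rw [h2]
  simp [circleMap, expj]

theorem norm_expj (ω : ℝ) : ‖expj ω‖ = 1 := Complex.norm_exp_ofReal_mul_I ω

theorem noisePower_eq_circleAverage (f H : ℂ[X]) :
    noisePower f H = circleAverage (fun z => ‖f.eval z‖ ^ 2 / ‖H.eval z‖ ^ 2) 0 1 := by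
  rw [circleAverage_expj, noisePower, smul_eq_mul]

theorem weightedInner_self (f H : ℂ[X]) : weightedInner H f f = (noisePower f H : ℂ) := by
  rw [weightedInner, circleAverage_expj, noisePower, Complex.real_smul, Complex.ofReal_mul,
    ← intervalIntegral.integral_ofReal]
  congr 2
  funext ω
  rw [← Complex.normSq_eq_conj_mul_self, Complex.normSq_eq_norm_sq]
  push_cast
  rfl

/-- The mean value property on the unit disc. -/
theorem circleAverage_eq_of_differentiableOn {f : ℂ → ℂ}
    (hf : DifferentiableOn ℂ f (Metric.closedBall 0 1)) : circleAverage f 0 1 = f 0 := by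
  have : DiffContOnCl ℂ f (Metric.ball 0 |1|) := by
    apply DifferentiableOn.diffContOnCl
    rw [closure_ball _ (by norm_num)]
    simpa using hf
  exact this.circleAverage

theorem conj_eq_inv {z : ℂ} (hz : ‖z‖ = 1) : conj z = z⁻¹ := by
  rw [Complex.inv_def, Complex.normSq_eq_norm_sq, hz]
  simp

theorem gramMatrix_one (n : ℕ) : gramMatrix n 1 = 1 := by
  have key (i k : ℕ) : weightedInner 1 (X ^ i) (X ^ (i + k)) = if k = 0 then 1 else 0 := by
    have : weightedInner 1 (X ^ i) (X ^ (i + k)) = circleAverage (fun z => z ^ k) 0 1 := by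
      refine Real.circleAverage_congr_sphere fun z hz => ?_
      have hz1 : ‖z‖ = 1 := by simpa using hz
      have hz0 : z ≠ 0 := by rintro rfl; simp at hz1
      simp only [eval_pow, eval_X, eval_one, map_pow, conj_eq_inv hz1, pow_add, eval_mul]
      simp only [inv_pow, norm_one, one_pow, Complex.ofReal_one, div_one]
      rw [inv_mul_cancel_left₀ (pow_ne_zero _ hz0)]
    rw [this, circleAverage_eq_of_differentiableOn (by fun_prop)]
    simp [zero_pow_eq]
  ext i j
  simp only [gramMatrix, Matrix.of_apply, Matrix.one_apply]
  rcases le_total (i : ℕ) j with h | h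
  · obtain ⟨k, hk⟩ := Nat.exists_eq_add_of_le h
    rw [hk, key]
    congr 1
    simp [Fin.ext_iff]; omega
  · obtain ⟨k, hk⟩ := Nat.exists_eq_add_of_le h
    rw [← weightedInner_conj, hk, key]
    have : (k = 0) ↔ i = j := by simp [Fin.ext_iff]; omega
    by_cases h0 : k = 0 <;> simp [h0, ← this]

/-- On the circle `1 / |z - w|² = z / (z - (conj w)⁻¹) · (-1) / (conj w (z - w))`, and Cauchy's
formula at `(conj w)⁻¹`, which lies inside, gives the value of the second factor there. -/
theorem circleAverage_inv_norm_sub_sq {w : ℂ} (hw : 1 < ‖w‖) :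
    circleAverage (fun z => (1 : ℂ) / (‖z - w‖ ^ 2 : ℝ)) 0 1 = 1 / (‖w‖ ^ 2 - 1 : ℝ) := by
  have hw0 : w ≠ 0 := by rintro rfl; simp at hw; linarith
  have hcw0 : conj w ≠ 0 := by simpa using hw0
  have hd : ∀ z : ℂ, ‖z‖ ≤ 1 → z - w ≠ 0 := fun z hz h => by
    rw [sub_eq_zero] at h; rw [h] at hz; linarith
  have hdiff : DifferentiableOn ℂ (fun z => -1 / (conj w * (z - w))) (Metric.closedBall 0 1) := by
    refine DifferentiableOn.div (by fun_prop) (by fun_prop) fun z hz => ?_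
    exact mul_ne_zero hcw0 (hd z (by simpa using hz))
  have h1 : DiffContOnCl ℂ (fun z => -1 / (conj w * (z - w))) (Metric.ball 0 |1|) := by
    apply DifferentiableOn.diffContOnCl
    rw [closure_ball _ (by norm_num)]
    simpa using hdiff
  have hmem : (conj w)⁻¹ ∈ Metric.ball (0 : ℂ) |1| := by
    simpa using inv_lt_one_of_one_lt₀ hw
  have h2 := h1.circleAverage_smul_div hmem
  have h3 : (conj w) * w = (‖w‖ ^ 2 : ℝ) := by
    rw [← Complex.normSq_eq_conj_mul_self, Complex.normSq_eq_norm_sq]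
  have h4 : ((‖w‖ ^ 2 - 1 : ℝ) : ℂ) ≠ 0 := by
    rw [Complex.ofReal_ne_zero]; nlinarith
  have h5 : conj w * ((conj w)⁻¹ - w) = -((‖w‖ ^ 2 - 1 : ℝ) : ℂ) := by
    rw [mul_sub, mul_inv_cancel₀ hcw0, h3]; push_cast; ring
  rw [h5, neg_div_neg_eq] at h2
  rw [← h2]
  refine Real.circleAverage_congr_sphere fun z hz => ?_
  have hz1 : ‖z‖ = 1 := by simpa using hz
  have hz0 : z ≠ 0 := by rintro rfl; simp at hz1
  have h6 : ((‖z - w‖ ^ 2 : ℝ) : ℂ) = (z⁻¹ - conj w) * (z - w) := by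
    rw [← Complex.normSq_eq_norm_sq, Complex.normSq_eq_conj_mul_self, map_sub, conj_eq_inv hz1]
  have h7 : z - (conj w)⁻¹ ≠ 0 := fun h => by
    rw [sub_eq_zero] at h
    rw [h] at hz1
    simp only [norm_inv, Complex.norm_conj] at hz1
    have := inv_lt_one_of_one_lt₀ hw
    linarith
  have h8 := hd z hz1.le
  have h9 : z⁻¹ - conj w ≠ 0 := fun h => h7 (by
    rw [sub_eq_zero] at h; rw [← h, inv_inv, sub_self])
  simp only [h6, smul_eq_mul, sub_zero]
  have h10 : z⁻¹ - conj w = -(conj w) * z⁻¹ * (z - (conj w)⁻¹) := by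
    field_simp; ring
  rw [h10]
  field_simp

/-! ### Gram determinants of all-pole spectra -/

/-- The monic polynomial with the multiset `s` of zeros. -/
noncomputable def zerosPoly (s : Multiset ℂ) : ℂ[X] := (s.map fun w => X - C w).prod

theorem zerosPoly_cons (w : ℂ) (s : Multiset ℂ) :
    zerosPoly (w ::ₘ s) = (X - C w) * zerosPoly s := by simp [zerosPoly]

theorem zerosPoly_eval_ne_zero {s : Multiset ℂ} (hs : ∀ w ∈ s, 1 < ‖w‖) {z : ℂ} (hz : ‖z‖ ≤ 1) :
    (zerosPoly s).eval z ≠ 0 := by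
  rw [zerosPoly, eval_multiset_prod, Multiset.map_map]
  refine Multiset.prod_ne_zero fun h => ?_
  obtain ⟨w, hw, h0⟩ := Multiset.mem_map.1 h
  simp only [Function.comp_apply, eval_sub, eval_X, eval_C, sub_eq_zero] at h0
  have := hs w hw
  rw [← h0] at this
  linarith

/-- The polynomial `∏_{w ∈ s} (1 - conj(w) D)`, the reflection of `zerosPoly s` in the unit circle.
On the circle the two have the same modulus (`reflectedZerosPoly_eval`). -/
noncomputable def reflectedZerosPoly (s : Multiset ℂ) : ℂ[X] :=
  (s.map fun w => 1 - C (conj w) * X).prod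

theorem reflectedZerosPoly_cons (w : ℂ) (s : Multiset ℂ) :
    reflectedZerosPoly (w ::ₘ s) = (1 - C (conj w) * X) * reflectedZerosPoly s := by
  simp [reflectedZerosPoly]

theorem reflectedZerosPoly_eval (s : Multiset ℂ) {z : ℂ} (hz : ‖z‖ = 1) :
    (reflectedZerosPoly s).eval z = z ^ Multiset.card s * conj ((zerosPoly s).eval z) := by
  have hz0 : z ≠ 0 := by rintro rfl; simp at hz
  induction s using Multiset.induction_on with
  | empty => simp [reflectedZerosPoly, zerosPoly]
  | cons w s ih =>
    rw [reflectedZerosPoly_cons, zerosPoly_cons, eval_mul, eval_mul, ih, Multiset.card_cons]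
    simp only [eval_sub, eval_one, eval_mul, eval_C, eval_X, map_mul, map_sub, conj_eq_inv hz]
    rw [pow_succ]
    field_simp

theorem natDegree_reflectedZerosPoly_le (s : Multiset ℂ) :
    (reflectedZerosPoly s).natDegree ≤ Multiset.card s := by
  induction s using Multiset.induction_on with
  | empty => simp [reflectedZerosPoly]
  | cons w s ih =>
    rw [reflectedZerosPoly_cons, Multiset.card_cons, add_comm]
    refine natDegree_mul_le_of_le ?_ ih
    compute_degree

/-- The polynomial `D^{n - |s|} ∏_{v ∈ s} (1 - conj(v) D)`, of degree at most `n` if `|s| ≤ n`. For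
the spectrum with zeros `w ::ₘ s` it spans the orthogonal complement of the multiples of `D - w` in
the polynomials of degree at most `n`. -/
noncomputable def innovation (n : ℕ) (s : Multiset ℂ) : ℂ[X] :=
  X ^ (n - Multiset.card s) * reflectedZerosPoly s

theorem natDegree_innovation_le {n : ℕ} {s : Multiset ℂ} (h : Multiset.card s ≤ n) :
    (innovation n s).natDegree ≤ n := by
  rw [innovation]
  refine (natDegree_mul_le_of_le (natDegree_X_pow_le _)
    (natDegree_reflectedZerosPoly_le s)).trans ?_
  omega

theorem innovation_eval {n : ℕ} {s : Multiset ℂ} (h : Multiset.card s ≤ n) {z : ℂ} (hz : ‖z‖ = 1) :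
    (innovation n s).eval z = z ^ n * conj ((zerosPoly s).eval z) := by
  rw [innovation, eval_mul, reflectedZerosPoly_eval s hz, ← mul_assoc, eval_pow, eval_X, ← pow_add,
    Nat.sub_add_cancel h]

/-- Multiplication by `D - w` is an isometry onto its range from the space with zeros `s` to the
space with zeros `w ::ₘ s`. -/
theorem weightedInner_shift_shift {w : ℂ} {s : Multiset ℂ} (hw : 1 < ‖w‖) (f g : ℂ[X]) :
    weightedInner (zerosPoly (w ::ₘ s)) ((X - C w) * f) ((X - C w) * g) =
      weightedInner (zerosPoly s) f g := by
  refine weightedInner_congr fun z hz => ?_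
  have h0 : z - w ≠ 0 := fun h => by rw [sub_eq_zero] at h; rw [h] at hz; linarith
  have h1 : ((‖z - w‖ : ℝ) : ℂ) ^ 2 = conj (z - w) * (z - w) := by
    rw [← Complex.normSq_eq_conj_mul_self, Complex.normSq_eq_norm_sq]; push_cast; rfl
  have h2 : conj (z - w) ≠ 0 := (_root_.map_ne_zero _).2 h0
  simp only [zerosPoly_cons, eval_mul, eval_sub, eval_X, eval_C, norm_mul, mul_pow,
    Complex.ofReal_mul, Complex.ofReal_pow, h1, map_mul]
  rw [show conj (z - w) * conj (eval z f) * ((z - w) * eval z g) =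
    (conj (z - w) * (z - w)) * (conj (eval z f) * eval z g) by ring,
    mul_div_mul_left _ _ (mul_ne_zero h2 h0)]

/-- On the circle the integrand is `D^{n-k} / ∏ (D - v)`, which is analytic in the closed disc and
vanishes at `0`. -/
theorem weightedInner_innovation_shift {w : ℂ} {s : Multiset ℂ} (hw : 1 < ‖w‖)
    (hs : ∀ w ∈ s, 1 < ‖w‖) {n k : ℕ} (hn : Multiset.card s ≤ n) (hk : k < n) :
    weightedInner (zerosPoly (w ::ₘ s)) ((X - C w) * X ^ k) (innovation n s) = 0 := by
  have hws : ∀ w' ∈ w ::ₘ s, 1 < ‖w'‖ := by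
    intro w' h
    rcases Multiset.mem_cons.1 h with rfl | h
    exacts [hw, hs _ h]
  have h1 : weightedInner (zerosPoly (w ::ₘ s)) ((X - C w) * X ^ k) (innovation n s) =
      circleAverage (fun z => z ^ (n - k) / (zerosPoly (w ::ₘ s)).eval z) 0 1 := by
    refine Real.circleAverage_congr_sphere fun z hz => ?_
    have hz1 : ‖z‖ = 1 := by simpa using hz
    have hz0 : z ≠ 0 := by rintro rfl; simp at hz1
    have h0 : z - w ≠ 0 := fun h => by rw [sub_eq_zero] at h; rw [h] at hz1; linarith
    have h2 : conj (z - w) ≠ 0 := (_root_.map_ne_zero _).2 h0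
    have h3 := zerosPoly_eval_ne_zero hs hz1.le
    have h4 : conj ((zerosPoly s).eval z) ≠ 0 := by simpa using h3
    have h5 (a : ℂ) : ((‖a‖ : ℝ) : ℂ) ^ 2 = conj a * a := by
      rw [← Complex.normSq_eq_conj_mul_self, Complex.normSq_eq_norm_sq]; push_cast; rfl
    simp only [zerosPoly_cons, eval_mul, eval_sub, eval_X, eval_C, norm_mul, mul_pow,
      Complex.ofReal_mul, Complex.ofReal_pow, h5, map_mul, innovation_eval hn hz1, eval_pow,
      map_pow]
    rw [show conj z ^ k = (z ^ k)⁻¹ by rw [conj_eq_inv hz1, inv_pow], pow_sub₀ z hz0 hk.le]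
    field_simp
  rw [h1, circleAverage_eq_of_differentiableOn]
  · rw [zero_pow (by omega), zero_div]
  · refine DifferentiableOn.div (by fun_prop) (Polynomial.differentiable _).differentiableOn
      fun z hz => ?_
    exact zerosPoly_eval_ne_zero hws (by simpa using hz)

/-- The reflection has the modulus of `zerosPoly s` on the circle, so only the factor
`1 / |D - w|²` is left of the integrand. -/
theorem weightedInner_innovation_self {w : ℂ} {s : Multiset ℂ} (hw : 1 < ‖w‖)
    (hs : ∀ w ∈ s, 1 < ‖w‖) {n : ℕ} (hn : Multiset.card s ≤ n) :
    weightedInner (zerosPoly (w ::ₘ s)) (innovation n s) (innovation n s) =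
      1 / (‖w‖ ^ 2 - 1 : ℝ) := by
  rw [← circleAverage_inv_norm_sub_sq hw]
  refine Real.circleAverage_congr_sphere fun z hz => ?_
  have hz1 : ‖z‖ = 1 := by simpa using hz
  have h3 : ((‖(zerosPoly s).eval z‖ ^ 2 : ℝ) : ℂ) ≠ 0 := by
    simpa using zerosPoly_eval_ne_zero hs hz1.le
  rw [← Complex.normSq_eq_conj_mul_self, Complex.normSq_eq_norm_sq, innovation_eval hn hz1,
    norm_mul, norm_pow, hz1, Complex.norm_conj, one_pow, one_mul, zerosPoly_cons, eval_mul,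
    norm_mul, mul_pow, eval_sub, eval_X, eval_C, Complex.ofReal_mul,
    mul_comm (((‖z - w‖ ^ 2 : ℝ) : ℂ)), ← div_div, div_self h3]

theorem det_eq_of_first_row {n : ℕ} (M : Matrix (Fin (n + 1)) (Fin (n + 1)) ℂ)
    (h : ∀ j : Fin n, M 0 j.succ = 0) :
    M.det = M 0 0 * (M.submatrix Fin.succ Fin.succ).det := by
  rw [Matrix.det_succ_row_zero, Fin.sum_univ_succ]
  simp [h]

/-- A basis of the polynomials of degree at most `n`: the polynomial `innovation n s`, followed by
the multiples `(D - w) D^k` of `D - w`, to which it is orthogonal. -/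
noncomputable def adaptedBasis (n : ℕ) (w : ℂ) (s : Multiset ℂ) : Fin (n + 1) → ℂ[X] :=
  Fin.cons (innovation n s) fun k : Fin n => (X - C w) * X ^ (k : ℕ)

/-- The matrix whose `j`-th column lists the coefficients of `u j` of degree less than `n`. -/
noncomputable def coeffMatrix {n : ℕ} (u : Fin n → ℂ[X]) : Matrix (Fin n) (Fin n) ℂ :=
  Matrix.of fun k j => (u j).coeff k

theorem natDegree_adaptedBasis_lt {n : ℕ} {w : ℂ} {s : Multiset ℂ} (hn : Multiset.card s ≤ n)
    (j : Fin (n + 1)) : (adaptedBasis n w s j).natDegree < n + 1 := by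
  refine Fin.cases ?_ (fun k => ?_) j
  · exact Nat.lt_succ_of_le (natDegree_innovation_le hn)
  · simp only [adaptedBasis, Fin.cons_succ]
    have : ((X - C w) * X ^ (k : ℕ)).natDegree ≤ 1 + (k : ℕ) :=
      natDegree_mul_le_of_le (natDegree_X_sub_C_le w) (natDegree_X_pow_le _)
    have := k.2
    omega

theorem conjTranspose_mul_gramMatrix_mul {H : ℂ[X]} (hH : ∀ z : ℂ, ‖z‖ = 1 → H.eval z ≠ 0)
    {n : ℕ} (u : Fin n → ℂ[X]) (hu : ∀ j, (u j).natDegree < n) :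
    (coeffMatrix u).conjTranspose * gramMatrix n H * coeffMatrix u =
      Matrix.of fun i j => weightedInner H (u i) (u j) := by
  ext i j
  rw [Matrix.of_apply, weightedInner_eq_sum hH (hu i) (hu j), Matrix.mul_apply, Finset.sum_comm]
  refine Finset.sum_congr rfl fun k _ => ?_
  rw [Matrix.mul_apply, Finset.sum_mul]
  rfl

theorem det_coeffMatrix_adaptedBasis {n : ℕ} (w : ℂ) {s : Multiset ℂ} (hn : Multiset.card s ≤ n) :
    (coeffMatrix (adaptedBasis n w s)).det = (innovation n s).eval w := by
  set U := coeffMatrix (adaptedBasis n w s) with hU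
  -- Replacing the first row of coefficients by the values at `w` is a unimodular operation.
  let W : Matrix (Fin (n + 1)) (Fin (n + 1)) ℂ :=
    Matrix.of fun i j => if i = 0 then w ^ (j : ℕ) else if i = j then 1 else 0
  have hW : W.det = 1 := by
    rw [Matrix.det_of_isUpperTriangular]
    · refine Finset.prod_eq_one fun i _ => ?_
      by_cases hi : i = 0 <;> simp [W, hi]
    · intro i j hij
      have hi : i ≠ 0 := by rintro rfl; exact absurd hij (by simp)
      have hne : i ≠ j := by rintro rfl; exact lt_irrefl _ hij
      simp [W, hi, hne]
  have h0 (j : Fin (n + 1)) : (W * U) 0 j = (adaptedBasis n w s j).eval w := by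
    rw [Matrix.mul_apply, eval_eq_sum_range' (natDegree_adaptedBasis_lt hn j),
      ← Fin.sum_univ_eq_sum_range (fun i => (adaptedBasis n w s j).coeff i * w ^ i)]
    exact Finset.sum_congr rfl fun i _ => by simp [W, U, coeffMatrix, mul_comm]
  have h1 (i : Fin n) (j : Fin (n + 1)) : (W * U) i.succ j = U i.succ j := by
    rw [Matrix.mul_apply]
    simp [W, Fin.succ_ne_zero]
  have h2 : ((W * U).submatrix Fin.succ Fin.succ).det = 1 := by
    have h3 (i j : Fin n) : (W * U).submatrix Fin.succ Fin.succ i j =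
        (X ^ ((j : ℕ) + 1) - C w * X ^ (j : ℕ)).coeff ((i : ℕ) + 1) := by
      rw [Matrix.submatrix_apply, h1]
      simp only [U, coeffMatrix, Matrix.of_apply, adaptedBasis, Fin.cons_succ, Fin.val_succ]
      congr 1
      ring
    rw [Matrix.det_of_isUpperTriangular]
    · refine Finset.prod_eq_one fun i _ => ?_
      rw [h3]
      simp [coeff_X_pow]
    · intro i j hij
      have : (j : ℕ) < i := hij
      rw [h3]
      simp only [coeff_sub, coeff_X_pow, coeff_C_mul]
      rw [if_neg (by omega), if_neg (by omega)]
      simp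
  have := det_eq_of_first_row (W * U) fun j => by
    rw [h0]; simp [adaptedBasis]
  rw [h0, h2, Matrix.det_mul, hW, one_mul, mul_one] at this
  rw [this]
  simp [adaptedBasis]

theorem norm_reflectedZerosPoly_eval (w : ℂ) (s : Multiset ℂ) :
    ‖(reflectedZerosPoly s).eval w‖ = (s.map fun v => ‖star v * w - 1‖).prod := by
  induction s using Multiset.induction_on with
  | empty => simp [reflectedZerosPoly]
  | cons v s ih =>
    rw [reflectedZerosPoly_cons, eval_mul, norm_mul, ih, Multiset.map_cons, Multiset.prod_cons]
    simp only [eval_sub, eval_one, eval_mul, eval_C, eval_X]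
    rw [norm_sub_rev]
    rfl

theorem norm_innovation_eval (n : ℕ) (w : ℂ) (s : Multiset ℂ) :
    ‖(innovation n s).eval w‖ =
      ‖w‖ ^ (n - Multiset.card s) * (s.map fun v => ‖star v * w - 1‖).prod := by
  rw [innovation, eval_mul, norm_mul, eval_pow, eval_X, norm_pow, norm_reflectedZerosPoly_eval]

/-- Removing the zero `w` from the spectrum and one from the dimension: in the basis
`adaptedBasis n w s` the Gram matrix splits into a `1 × 1` block and the Gram matrix of the smaller
problem. -/
theorem det_gramMatrix_cons {w : ℂ} {s : Multiset ℂ} (hw : 1 < ‖w‖)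
    (hs : ∀ w ∈ s, 1 < ‖w‖) {n : ℕ} (hn : Multiset.card s ≤ n) :
    ‖(gramMatrix (n + 1) (zerosPoly (w ::ₘ s))).det‖ * ‖(innovation n s).eval w‖ ^ 2 *
      (‖w‖ ^ 2 - 1) = ‖(gramMatrix n (zerosPoly s)).det‖ := by
  have hws : ∀ w' ∈ w ::ₘ s, 1 < ‖w'‖ := by
    intro w' h
    rcases Multiset.mem_cons.1 h with rfl | h
    exacts [hw, hs _ h]
  have h1 := conjTranspose_mul_gramMatrix_mul
    (H := zerosPoly (w ::ₘ s)) (fun z hz => zerosPoly_eval_ne_zero hws hz.le)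
    (adaptedBasis n w s) (natDegree_adaptedBasis_lt hn)
  have h2 := congrArg (fun M => ‖Matrix.det M‖) h1
  simp only [Matrix.det_mul, Matrix.det_conjTranspose, norm_mul, norm_star,
    det_coeffMatrix_adaptedBasis w hn] at h2
  have hpos : 0 < ‖w‖ ^ 2 - 1 := by nlinarith
  rw [det_eq_of_first_row (Matrix.of fun i j => weightedInner (zerosPoly (w ::ₘ s))
    (adaptedBasis n w s i) (adaptedBasis n w s j))] at h2
  · have h3 : (Matrix.of fun i j => weightedInner (zerosPoly (w ::ₘ s)) (adaptedBasis n w s i)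
        (adaptedBasis n w s j)).submatrix Fin.succ Fin.succ = gramMatrix n (zerosPoly s) := by
      ext i j
      simp only [Matrix.submatrix_apply, Matrix.of_apply, adaptedBasis, Fin.cons_succ, gramMatrix]
      exact weightedInner_shift_shift hw _ _
    rw [h3, Matrix.of_apply] at h2
    simp only [adaptedBasis, Fin.cons_zero, weightedInner_innovation_self hw hs hn] at h2
    rw [norm_mul, norm_div, norm_one, Complex.norm_real, Real.norm_of_nonneg hpos.le] at h2
    field_simp at h2
    linarith
  · intro j
    simp only [Matrix.of_apply, adaptedBasis, Fin.cons_succ, Fin.cons_zero]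
    rw [← weightedInner_conj, weightedInner_innovation_shift hw hs hn j.2, map_zero]

/-- The Gram determinant for a spectrum `1 / ∏ |D - z|²` with all zeros `z` outside the disc, in
any dimension at least the number of zeros. -/
theorem norm_det_gramMatrix_zerosPoly (s : Multiset ℂ) (hs : ∀ w ∈ s, 1 < ‖w‖) (m : ℕ) :
    ‖(gramMatrix (Multiset.card s + m) (zerosPoly s)).det‖ * ‖s.prod‖ ^ (2 * m) *
      (s.map fun z => (s.map fun w => ‖star z * w - 1‖).prod).prod = 1 := by
  induction s using Multiset.induction_on with
  | empty =>
    simp [zerosPoly, gramMatrix_one]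
  | cons w s ih =>
    have hw := hs w (Multiset.mem_cons_self w s)
    have hs' : ∀ w ∈ s, 1 < ‖w‖ := fun v hv => hs v (Multiset.mem_cons_of_mem hv)
    have h1 := det_gramMatrix_cons hw hs' (n := Multiset.card s + m) (by omega)
    have ih := ih hs'
    rw [← h1, norm_innovation_eval, Nat.add_sub_cancel_left] at ih
    have e1 : Multiset.card s + m + 1 = Multiset.card (w ::ₘ s) + m := by
      rw [Multiset.card_cons]; ring
    rw [e1] at ih
    simp only [Multiset.map_cons, Multiset.prod_cons, Multiset.prod_map_mul, norm_mul]
    have e2 : ‖star w * w - 1‖ = ‖w‖ ^ 2 - 1 := by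
      have : star w * w - 1 = ((‖w‖ ^ 2 - 1 : ℝ) : ℂ) := by
        rw [Complex.star_def, ← Complex.normSq_eq_conj_mul_self, Complex.normSq_eq_norm_sq]
        push_cast; rfl
      rw [this, Complex.norm_real, Real.norm_of_nonneg]
      nlinarith
    have e3 : (s.map fun v => ‖star w * v - 1‖).prod = (s.map fun v => ‖star v * w - 1‖).prod := by
      congr 1
      refine Multiset.map_congr rfl fun v _ => ?_
      rw [← norm_star, star_sub, star_mul, star_star, star_one]
    rw [e2, e3]
    refine Eq.trans ?_ ih
    generalize (s.map fun v => ‖star v * w - 1‖).prod = P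
    generalize (s.map fun z => (s.map fun w => ‖star z * w - 1‖).prod).prod = Q
    ring

/-! ### Spectral factorization of the channel -/

theorem infinite_unit_circle : {z : ℂ | ‖z‖ = 1}.Infinite := by
  have h : IsPreconnected (Metric.sphere (0 : ℂ) 1) :=
    isPreconnected_sphere (by rw [Complex.rank_real_complex]; norm_num) 0 1
  have h2 : (Metric.sphere (0 : ℂ) 1).Nontrivial := ⟨1, by simp, -1, by simp, by norm_num⟩
  have := h.infinite_of_nontrivial h2
  convert this using 1
  ext z; simp

theorem eq_of_eval_unit_circle {f g : ℂ[X]} (h : ∀ z : ℂ, ‖z‖ = 1 → f.eval z = g.eval z) :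
    f = g :=
  eq_of_infinite_eval_eq f g (infinite_unit_circle.mono fun z hz => h z hz)

theorem conjReverse_eval {p : ℕ} (h : Fin (p + 1) → ℂ) {z : ℂ} (hz : ‖z‖ = 1) :
    (conjReverse h).eval z = z ^ p * conj ((channel h).eval z) := by
  have hz0 : z ≠ 0 := by rintro rfl; simp at hz
  simp only [conjReverse, channel, eval_finsetSum, eval_mul, eval_C, eval_pow, eval_X, map_sum,
    map_mul, map_pow, conj_eq_inv hz, Finset.mul_sum]
  refine Finset.sum_congr rfl fun k _ => ?_
  rw [pow_sub₀ z hz0 (Nat.lt_succ_iff.1 k.2), inv_pow, Complex.star_def]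
  ring

theorem natDegree_channel_le {p : ℕ} (h : Fin (p + 1) → ℂ) : (channel h).natDegree ≤ p := by
  refine natDegree_sum_le_of_forall_le _ _ fun k _ => ?_
  exact (natDegree_C_mul_X_pow_le _ _).trans (Nat.lt_succ_iff.1 k.2)

theorem eq_C_mul_zerosPoly (H : ℂ[X]) : H = C H.leadingCoeff * zerosPoly H.roots :=
  (IsAlgClosed.splits H).eq_prod_roots

theorem reflectedZerosPoly_ne_zero (s : Multiset ℂ) : reflectedZerosPoly s ≠ 0 := by
  have h0 : (reflectedZerosPoly s).eval 0 = 1 := by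
    induction s using Multiset.induction_on with
    | empty => simp [reflectedZerosPoly]
    | cons w s ih => simp [reflectedZerosPoly_cons, ih]
  intro h
  simp [h] at h0

theorem conjReverse_eq {p : ℕ} (h : Fin (p + 1) → ℂ) :
    conjReverse h = C (conj (channel h).leadingCoeff) *
      (X ^ (p - Multiset.card (channel h).roots) * reflectedZerosPoly (channel h).roots) := by
  have hp : Multiset.card (channel h).roots ≤ p :=
    (card_roots' _).trans (natDegree_channel_le h)
  refine eq_of_eval_unit_circle fun z hz => ?_
  rw [conjReverse_eval h hz, eval_mul, eval_C]
  have := innovation_eval hp hz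
  rw [innovation] at this
  rw [this]
  conv_lhs => rw [eq_C_mul_zerosPoly (channel h)]
  rw [eval_mul, eval_C, map_mul]
  ring

open Classical in
/-- The zeros outside the closed unit disc of `f` times its reflection, in terms of the multiset
`s` of zeros of `f`: those of `s` that lie outside, and the reflections of those inside. -/
noncomputable def outerZeros (s : Multiset ℂ) : Multiset ℂ :=
  (s + (reflectedZerosPoly s).roots).filter fun z => 1 < ‖z‖

theorem maxPhaseZeros_eq_outerZeros {p : ℕ} (h : Fin (p + 1) → ℂ) (h0 : channel h ≠ 0) :
    maxPhaseZeros h = outerZeros (channel h).roots := by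
  have hc : conj (channel h).leadingCoeff ≠ 0 := by simpa using h0
  have h1 : (X : ℂ[X]) ^ (p - Multiset.card (channel h).roots) *
      reflectedZerosPoly (channel h).roots ≠ 0 :=
    mul_ne_zero (pow_ne_zero _ X_ne_zero) (reflectedZerosPoly_ne_zero _)
  have h2 : conjReverse h ≠ 0 := by
    rw [conjReverse_eq]
    exact mul_ne_zero (by rwa [Ne, C_eq_zero]) h1
  rw [maxPhaseZeros, roots_mul (mul_ne_zero h0 h2), conjReverse_eq, roots_C_mul _ hc,
    roots_mul h1, outerZeros]
  simp only [Multiset.filter_add, roots_X_pow]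
  congr 1
  convert zero_add _
  rw [Multiset.filter_eq_nil]
  intro a ha
  rw [Multiset.mem_nsmul] at ha
  have : a = 0 := by simpa using ha.2
  simp [this]

theorem roots_one_sub_conj_mul_X {w : ℂ} (hw : w ≠ 0) :
    (1 - C (conj w) * X : ℂ[X]).roots = {(conj w)⁻¹} := by
  have hcw : conj w ≠ 0 := by rwa [_root_.map_ne_zero]
  have h1 : (1 - C (conj w) * X : ℂ[X]) = C (-conj w) * (X - C (conj w)⁻¹) := by
    rw [mul_sub, ← C_mul, neg_mul, mul_inv_cancel₀ hcw]; simp; ring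
  rw [h1, roots_C_mul _ (neg_ne_zero.2 hcw), roots_X_sub_C]

theorem outerZeros_cons_of_one_lt {w : ℂ} (hw : 1 < ‖w‖) (s : Multiset ℂ) :
    outerZeros (w ::ₘ s) = w ::ₘ outerZeros s := by
  have hw0 : w ≠ 0 := by rintro rfl; simp at hw; linarith
  rw [outerZeros, outerZeros, reflectedZerosPoly_cons, roots_mul (by
    rw [← reflectedZerosPoly_cons]; exact reflectedZerosPoly_ne_zero _),
    roots_one_sub_conj_mul_X hw0]
  rw [Multiset.cons_add, Multiset.filter_cons_of_pos (p := fun z : ℂ => 1 < ‖z‖) _ hw]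
  simp only [Multiset.filter_add]
  rw [Multiset.filter_singleton, if_neg]
  · simp
  · simp only [norm_inv, Complex.norm_conj, not_lt]
    exact (inv_lt_one_of_one_lt₀ hw).le

theorem outerZeros_zero_cons (s : Multiset ℂ) :
    outerZeros (0 ::ₘ s) = outerZeros s := by
  rw [outerZeros, outerZeros, reflectedZerosPoly_cons]
  simp

theorem outerZeros_cons_of_lt_one {w : ℂ} (hw0 : w ≠ 0) (hw : ‖w‖ < 1) (s : Multiset ℂ) :
    outerZeros (w ::ₘ s) = (conj w)⁻¹ ::ₘ outerZeros s := by
  rw [outerZeros, outerZeros, reflectedZerosPoly_cons, roots_mul (by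
    rw [← reflectedZerosPoly_cons]; exact reflectedZerosPoly_ne_zero _),
    roots_one_sub_conj_mul_X hw0]
  rw [Multiset.cons_add,
    Multiset.filter_cons_of_neg (p := fun z : ℂ => 1 < ‖z‖) _ hw.le.not_gt]
  simp only [Multiset.filter_add]
  rw [Multiset.filter_singleton, if_pos]
  · rw [← Multiset.singleton_add]
    abel
  · rw [norm_inv, Complex.norm_conj]
    exact (one_lt_inv₀ (norm_pos_iff.2 hw0)).2 hw

/-- Reflecting a zero `w ≠ 0` inside the disc to `1 / conj w` multiplies `|z - w|` by a constant on
the circle, and a zero at `0` contributes the constant `1`. -/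
theorem exists_norm_zerosPoly_eq (s : Multiset ℂ) (hs : ∀ w ∈ s, ‖w‖ ≠ 1) :
    Multiset.card (outerZeros s) ≤ Multiset.card s ∧ ∃ K : ℝ, 0 < K ∧ ∀ z : ℂ, ‖z‖ = 1 →
      ‖(zerosPoly s).eval z‖ = K * ‖(zerosPoly (outerZeros s)).eval z‖ := by
  induction s using Multiset.induction_on with
  | empty =>
    have : outerZeros 0 = 0 := by simp [outerZeros, reflectedZerosPoly]
    exact ⟨by simp [this], 1, one_pos, by simp [this]⟩
  | cons w s ih =>
    obtain ⟨hc, K, hK, h⟩ := ih fun v hv => hs v (Multiset.mem_cons_of_mem hv)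
    have hw := hs w (Multiset.mem_cons_self w s)
    rcases lt_or_gt_of_ne hw with hw | hw
    · by_cases hw0 : w = 0
      · subst hw0
        rw [outerZeros_zero_cons]
        refine ⟨hc.trans (by simp), K, hK, fun z hz => ?_⟩
        rw [zerosPoly_cons, eval_mul, norm_mul, h z hz]
        simp [hz]
      · rw [outerZeros_cons_of_lt_one hw0 hw]
        refine ⟨by simpa using hc, ‖w‖ * K, mul_pos (norm_pos_iff.2 hw0) hK, fun z hz => ?_⟩
        have hcw0 : conj w ≠ 0 := by rwa [_root_.map_ne_zero]
        have hz0 : z ≠ 0 := by rintro rfl; simp at hz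
        have h1 : ‖z - w‖ = ‖w‖ * ‖z - (conj w)⁻¹‖ := by
          rw [← Complex.norm_conj (z - w), ← Complex.norm_conj w, ← norm_mul, map_sub,
            conj_eq_inv hz, mul_sub, mul_inv_cancel₀ hcw0, ← one_mul ‖z⁻¹ - conj w‖, ← hz,
            ← norm_mul, mul_sub, mul_inv_cancel₀ hz0, norm_sub_rev, mul_comm]
        rw [zerosPoly_cons, zerosPoly_cons, eval_mul, eval_mul, norm_mul, norm_mul, h z hz]
        simp only [eval_sub, eval_X, eval_C]
        rw [h1]
        ring
    · rw [outerZeros_cons_of_one_lt hw]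
      refine ⟨by simpa using hc, K, hK, fun z hz => ?_⟩
      rw [zerosPoly_cons, zerosPoly_cons, eval_mul, eval_mul, norm_mul, norm_mul, h z hz]
      ring

/-- Jensen's formula for a polynomial without zeros in the closed disc. -/
theorem circleAverage_log_norm_zerosPoly (s : Multiset ℂ) (hs : ∀ w ∈ s, 1 < ‖w‖) :
    circleAverage (fun z => Real.log ‖(zerosPoly s).eval z‖) 0 1 = Real.log ‖s.prod‖ := by
  induction s using Multiset.induction_on with
  | empty => simp [zerosPoly, Real.circleAverage]
  | cons w s ih =>
    have hw := hs w (Multiset.mem_cons_self w s)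
    have hs' : ∀ w ∈ s, 1 < ‖w‖ := fun v hv => hs v (Multiset.mem_cons_of_mem hv)
    have hI : CircleIntegrable (fun z => Real.log ‖(zerosPoly s).eval z‖) 0 1 := by
      refine ContinuousOn.circleIntegrable' ?_
      refine ContinuousOn.log (by fun_prop) fun z hz => ?_
      rw [norm_ne_zero_iff]
      exact zerosPoly_eval_ne_zero hs' (by simpa using hz.le)
    have hp : s.prod ≠ 0 := Multiset.prod_ne_zero fun h => by
      have := hs' 0 h; simp at this; linarith
    have hw0 : w ≠ 0 := by rintro rfl; simp at hw; linarith
    rw [Multiset.prod_cons, norm_mul, Real.log_mul (norm_ne_zero_iff.2 hw0)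
      (norm_ne_zero_iff.2 hp), ← ih hs', ← circleAverage_log_norm_sub_const₂ hw,
      ← Real.circleAverage_fun_add (circleIntegrable_log_norm_sub_const 1) hI]
    refine Real.circleAverage_congr_sphere fun z hz => ?_
    have hz1 : ‖z‖ ≤ 1 := by simpa using hz.le
    have h0 : z - w ≠ 0 := fun h => by rw [sub_eq_zero] at h; rw [h] at hz1; linarith
    simp only [zerosPoly_cons, eval_mul, norm_mul, eval_sub, eval_X, eval_C]
    rw [Real.log_mul (norm_ne_zero_iff.2 h0)
      (norm_ne_zero_iff.2 (zerosPoly_eval_ne_zero hs' hz1))]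

/-- On the circle the channel has, up to a constant, the modulus of its maximum-phase counterpart.
There are at most `p` maximum-phase zeros, and fewer than `p` exactly if `h₀ h_p = 0`. -/
theorem exists_spectral_factor {p : ℕ} (h : Fin (p + 1) → ℂ)
    (hH : ∀ z : ℂ, ‖z‖ = 1 → (channel h).eval z ≠ 0) :
    Multiset.card (maxPhaseZeros h) ≤ p ∧ ∃ K : ℝ, 0 < K ∧ ∀ z : ℂ, ‖z‖ = 1 →
      ‖(channel h).eval z‖ = K * ‖(zerosPoly (maxPhaseZeros h)).eval z‖ := by
  have h0 : channel h ≠ 0 := fun h0 => hH 1 (by simp) (by simp [h0])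
  rw [maxPhaseZeros_eq_outerZeros h h0]
  obtain ⟨hc, K, hK, h1⟩ := exists_norm_zerosPoly_eq (channel h).roots fun w hw hw1 =>
    hH w hw1 ((mem_roots h0).1 hw)
  refine ⟨hc.trans ((card_roots' _).trans (natDegree_channel_le h)),
    ‖(channel h).leadingCoeff‖ * K, mul_pos (by simpa using h0) hK, fun z hz => ?_⟩
  conv_lhs => rw [eq_C_mul_zerosPoly (channel h)]
  rw [eval_mul, eval_C, norm_mul, h1 z hz, mul_assoc]

theorem dfeNoisePower_eq {H : ℂ[X]} {s : Multiset ℂ} (hs : ∀ w ∈ s, 1 < ‖w‖) {K : ℝ} (hK : 0 < K)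
    (h : ∀ z : ℂ, ‖z‖ = 1 → ‖H.eval z‖ = K * ‖(zerosPoly s).eval z‖) :
    dfeNoisePower H = ((K * ‖s.prod‖) ^ 2)⁻¹ := by
  have hp : s.prod ≠ 0 := Multiset.prod_ne_zero fun h => by
    have := hs 0 h; simp at this; linarith
  have hI : CircleIntegrable (fun z => Real.log ‖(zerosPoly s).eval z‖) 0 1 := by
    refine ContinuousOn.circleIntegrable' ?_
    refine ContinuousOn.log (by fun_prop) fun z hz => ?_
    rw [norm_ne_zero_iff]
    exact zerosPoly_eval_ne_zero hs (by simpa using hz.le)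
  have h1 : circleAverage (fun z => Real.log (‖H.eval z‖ ^ 2)) 0 1 =
      2 * (Real.log K + Real.log ‖s.prod‖) := by
    rw [← circleAverage_log_norm_zerosPoly s hs, ← Real.circleAverage_const (Real.log K) 0 1,
      ← Real.circleAverage_fun_add (circleIntegrable_const _ _ _) hI, ← smul_eq_mul,
      ← Real.circleAverage_fun_smul]
    refine Real.circleAverage_congr_sphere fun z hz => ?_
    have hz1 : ‖z‖ = 1 := by simpa using hz
    simp only [h z hz1]
    rw [Real.log_pow, Real.log_mul hK.ne'
      (norm_ne_zero_iff.2 (zerosPoly_eval_ne_zero hs hz1.le))]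
    simp
  rw [circleAverage_expj, smul_eq_mul] at h1
  have hpp : 0 < ‖s.prod‖ := norm_pos_iff.2 hp
  rw [dfeNoisePower, h1, Real.exp_neg, ← Real.log_mul hK.ne' hpp.ne', mul_comm, Real.exp_mul,
    Real.exp_log (by positivity), Real.rpow_two]

theorem gramMatrix_eq_smul {H P : ℂ[X]} {K : ℝ}
    (h : ∀ z : ℂ, ‖z‖ = 1 → ‖H.eval z‖ = K * ‖P.eval z‖) (n : ℕ) :
    gramMatrix n H = ((K ^ 2)⁻¹ : ℂ) • gramMatrix n P := by
  ext i j
  simp only [gramMatrix, Matrix.of_apply, Matrix.smul_apply, smul_eq_mul]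
  rw [← weightedInner_C_mul_right]
  refine weightedInner_congr fun z hz => ?_
  rw [h z hz, mul_pow, eval_mul, eval_C]
  push_cast
  ring

/-- The Toeplitz determinant is at most `σ^{2n} α_H`. Equality can fail if there are fewer than `p`
maximum-phase zeros, since then the exponent `2p` in `α_H` exceeds twice their number. -/
theorem alpha_pos_and_det_bound {p : ℕ} (h : Fin (p + 1) → ℂ)
    (hH : ∀ z : ℂ, ‖z‖ = 1 → (channel h).eval z ≠ 0) {n : ℕ} (hn : p + 1 ≤ n) :
    0 < alpha h ∧ 0 < ‖(gramMatrix n (channel h)).det‖ ∧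
      ‖(gramMatrix n (channel h)).det‖ ≤ dfeNoisePower (channel h) ^ n * alpha h := by
  obtain ⟨hc, K, hK, h1⟩ := exists_spectral_factor h hH
  have hs : ∀ w ∈ maxPhaseZeros h, 1 < ‖w‖ := fun w hw => (Multiset.mem_filter.1 hw).2
  have hdfe := dfeNoisePower_eq hs hK h1
  unfold alpha
  set s := maxPhaseZeros h
  obtain ⟨m, hm⟩ := Nat.exists_eq_add_of_le (hc.trans (by omega : p ≤ n))
  have h2 := norm_det_gramMatrix_zerosPoly s hs m
  have h3 : 1 ≤ ‖s.prod‖ := by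
    clear_value s
    clear hdfe h1 hc hm h2
    induction s using Multiset.induction_on with
    | empty => simp
    | cons w s ih =>
      rw [Multiset.prod_cons, norm_mul]
      exact one_le_mul_of_one_le_of_one_le (hs w (Multiset.mem_cons_self w s)).le
        (ih fun v hv => hs v (Multiset.mem_cons_of_mem hv))
  rw [← hm] at h2
  set R := ‖s.prod‖
  set Q := (s.map fun z => (s.map fun w => ‖star z * w - 1‖).prod).prod
  set D := ‖(gramMatrix n (zerosPoly s)).det‖
  have hQ0 : 0 ≤ Q := by
    refine Multiset.prod_nonneg fun x hx => ?_
    obtain ⟨z, _, rfl⟩ := Multiset.mem_map.1 hx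
    refine Multiset.prod_nonneg fun x hx => ?_
    obtain ⟨w, _, rfl⟩ := Multiset.mem_map.1 hx
    exact norm_nonneg _
  have hQ : 0 < Q := lt_of_le_of_ne hQ0 fun h0 => by rw [← h0] at h2; simp at h2
  have hR : 0 < R := by linarith
  have hD : D = 1 / (R ^ (2 * m) * Q) := by
    rw [eq_div_iff (by positivity)]
    linarith
  have hdet : ‖(gramMatrix n (channel h)).det‖ = ((K ^ 2)⁻¹) ^ n * D := by
    rw [gramMatrix_eq_smul h1, Matrix.det_smul, norm_mul, norm_pow, norm_inv, norm_pow,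
      Complex.norm_real, Real.norm_of_nonneg hK.le, Fintype.card_fin]
  refine ⟨by positivity, ?_, ?_⟩
  · rw [hdet, hD]; positivity
  · rw [hdet, hD, hdfe, mul_pow, mul_inv, mul_pow ((K ^ 2)⁻¹), mul_assoc]
    refine mul_le_mul_of_nonneg_left ?_ (by positivity)
    have h4 : R ^ (2 * n) ≤ R ^ (2 * p) * R ^ (2 * m) := by
      rw [← pow_add]
      exact pow_le_pow_right₀ h3 (by omega)
    rw [inv_pow, ← pow_mul, inv_mul_eq_div, div_div,
      div_le_div_iff₀ (by positivity) (by positivity)]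
    nlinarith [mul_le_mul_of_nonneg_right h4 hQ0]

/-! ### Integer filters from Minkowski's theorem -/

open scoped ComplexOrder MatrixOrder Matrix.Norms.L2Operator in
theorem exists_conjTranspose_mul_self {𝕜 : Type*} [RCLike 𝕜] {n : Type*} [Fintype n]
    [DecidableEq n] {A : Matrix n n 𝕜} (hA : A.PosSemidef) :
    ∃ B : Matrix n n 𝕜, A = B.conjTranspose * B :=
  CStarAlgebra.nonneg_iff_eq_star_mul_self.mp hA.nonneg

theorem noisePower_nonneg (f H : ℂ[X]) : 0 ≤ noisePower f H := by
  rw [noisePower_eq_circleAverage]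
  exact Real.circleAverage_nonneg_of_nonneg fun z _ => by positivity

/-- A factorization `Bᴴ B` of the Gram matrix makes the noise power the squared length of `B` times
the vector of coefficients. -/
theorem noisePower_eq_sum_sq {H : ℂ[X]} (hH : ∀ z : ℂ, ‖z‖ = 1 → H.eval z ≠ 0) {n : ℕ}
    {B : Matrix (Fin n) (Fin n) ℂ} (hB : gramMatrix n H = B.conjTranspose * B) {f : ℂ[X]}
    (hf : f.natDegree < n) :
    noisePower f H = ∑ i, ‖B.mulVec (fun k : Fin n => f.coeff k) i‖ ^ 2 := by
  have h := weightedInner_self f H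
  rw [weightedInner_eq_sum hH hf hf, hB] at h
  rw [← Complex.ofReal_inj, ← h]
  push_cast
  set v : Fin n → ℂ := fun k => f.coeff k
  have h2 : ∑ i, ((‖B.mulVec v i‖ : ℝ) : ℂ) ^ 2 = dotProduct (star (B.mulVec v)) (B.mulVec v) := by
    refine Finset.sum_congr rfl fun i _ => ?_
    rw [Pi.star_apply, Complex.star_def, ← Complex.normSq_eq_conj_mul_self,
      Complex.normSq_eq_norm_sq]
    push_cast; rfl
  rw [h2, Matrix.star_mulVec, ← Matrix.dotProduct_mulVec, Matrix.mulVec_mulVec]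
  simp only [dotProduct, Matrix.mulVec, Finset.mul_sum, v, Pi.star_apply, Complex.star_def]
  exact Finset.sum_congr rfl fun i _ => Finset.sum_congr rfl fun j _ => by ring

/-- The polynomial `∑ a_k D^k` with the coefficient vector `a`. -/
noncomputable def vecPoly {R : Type*} [Semiring R] {n : ℕ} (a : Fin n → R) : R[X] :=
  ∑ k : Fin n, C (a k) * X ^ (k : ℕ)

theorem vecPoly_coeff {R : Type*} [Semiring R] {n : ℕ} (a : Fin n → R) (k : Fin n) :
    (vecPoly a).coeff k = a k := by
  simp [vecPoly, coeff_X_pow, Fin.val_inj]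

theorem vecPoly_ne_zero {R : Type*} [Semiring R] {n : ℕ} {a : Fin n → R} (ha : a ≠ 0) :
    vecPoly a ≠ 0 := by
  intro h
  refine ha (funext fun k => ?_)
  rw [← vecPoly_coeff a k, h]
  simp

theorem natDegree_vecPoly_lt {R : Type*} [Semiring R] {n : ℕ} (hn : 0 < n) (a : Fin n → R) :
    (vecPoly a).natDegree < n := by
  refine lt_of_le_of_lt (natDegree_sum_le_of_forall_le (n := n - 1) _ _ fun k _ => ?_) (by omega)
  exact (natDegree_C_mul_X_pow_le _ _).trans (by have := k.2; omega)

theorem star_dotProduct_gramMatrix_mulVec {H : ℂ[X]} (hH : ∀ z : ℂ, ‖z‖ = 1 → H.eval z ≠ 0) {n : ℕ}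
    (hn : 0 < n) (x : Fin n → ℂ) :
    dotProduct (star x) ((gramMatrix n H).mulVec x) = (noisePower (vecPoly x) H : ℂ) := by
  rw [← weightedInner_self, weightedInner_eq_sum hH (natDegree_vecPoly_lt hn x)
    (natDegree_vecPoly_lt hn x)]
  simp only [dotProduct, Matrix.mulVec, Finset.mul_sum, Pi.star_apply, Complex.star_def,
    vecPoly_coeff, mul_assoc]

open ComplexOrder in
theorem gramMatrix_posSemidef {H : ℂ[X]} (hH : ∀ z : ℂ, ‖z‖ = 1 → H.eval z ≠ 0) {n : ℕ}
    (hn : 0 < n) : (gramMatrix n H).PosSemidef := by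
  refine Matrix.PosSemidef.of_dotProduct_mulVec_nonneg (gramMatrix_isHermitian n H) fun x => ?_
  rw [star_dotProduct_gramMatrix_mulVec hH hn]
  exact Complex.zero_le_real.2 (noisePower_nonneg _ _)

theorem rpow_bound {D σ a : ℝ} {n : ℕ} (hn : 0 < n) (hD : 0 ≤ D) (hσ : 0 ≤ σ)
    (ha : 0 ≤ a) (h : D ≤ σ ^ n * a) :
    D ^ (1 / (n : ℝ)) ≤ σ * a ^ (1 / (n : ℝ)) := by
  have hn0 : (n : ℝ) ≠ 0 := by positivity
  refine (Real.rpow_le_rpow hD h (by positivity)).trans_eq ?_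
  rw [Real.mul_rpow (by positivity) ha, ← Real.rpow_natCast σ n, ← Real.rpow_mul hσ,
    mul_one_div_cancel hn0, Real.rpow_one]

/-- The real and imaginary parts of the coefficients turn the Hermitian form in `n` variables into
a real form in `2n` variables, whose determinant is the square of the Hermitian one. -/
theorem exists_gaussian_filter {H : ℂ[X]} (hH : ∀ z : ℂ, ‖z‖ = 1 → H.eval z ≠ 0) {n : ℕ}
    (hn : 0 < n) (hdet : (gramMatrix n H).det ≠ 0) :
    ∃ J : GaussianInt[X], J ≠ 0 ∧ noisePower (J.map GaussianInt.toComplex) H ≤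
      etaComplex n * ‖(gramMatrix n H).det‖ ^ (1 / (n : ℝ)) := by
  obtain ⟨B, hB⟩ := exists_conjTranspose_mul_self (gramMatrix_posSemidef hH hn)
  have hdB : ‖(gramMatrix n H).det‖ = ‖B.det‖ ^ 2 := by
    rw [hB, Matrix.det_mul, Matrix.det_conjTranspose, norm_mul, norm_star, sq]
  -- Coordinates: real and imaginary parts of the components of a vector in `ℂⁿ`.
  let b : Module.Basis (Σ _ : Fin n, Fin 2) ℝ (Fin n → ℂ) := Pi.basis fun _ => Complex.basisOneI
  let L : (Fin n → ℂ) →ₗ[ℝ] (Fin n → ℂ) := (Matrix.toLin' B).restrictScalars ℝ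
  let M := LinearMap.toMatrix b b L
  have hM : M.det = ‖B.det‖ ^ 2 := by
    rw [LinearMap.det_toMatrix, LinearMap.det_restrictScalars, LinearMap.det_toLin',
      Algebra.norm_complex_apply, Complex.normSq_eq_norm_sq]
  have hM0 : M.det ≠ 0 := by
    rw [hM, ← hdB]; exact norm_ne_zero_iff.2 hdet
  have hb0 (x : Fin n → ℂ) (i : Fin n) : b.repr x ⟨i, 0⟩ = (x i).re := by
    simp [b, Pi.basis_repr]
  have hb1 (x : Fin n → ℂ) (i : Fin n) : b.repr x ⟨i, 1⟩ = (x i).im := by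
    simp [b, Pi.basis_repr]
  have : Nonempty (Σ _ : Fin n, Fin 2) := ⟨⟨⟨0, hn⟩, 0⟩⟩
  obtain ⟨x, hx0, hx⟩ := exists_int_ne_zero_sum_sq_le M hM0
  let a : Fin n → GaussianInt := fun i => ⟨x ⟨i, 0⟩, x ⟨i, 1⟩⟩
  have ha0 : a ≠ 0 := by
    intro h
    refine hx0 (funext fun ⟨i, j⟩ => ?_)
    have h1 := congrFun h i
    fin_cases j
    · exact congrArg Zsqrtd.re h1
    · exact congrArg Zsqrtd.im h1
  let v : Fin n → ℂ := fun i => GaussianInt.toComplex (a i)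
  have hv : (fun i => (x i : ℝ)) = b.repr v := by
    funext ⟨i, j⟩
    fin_cases j
    · exact ((hb0 v i).trans (by simp [v, a])).symm
    · exact ((hb1 v i).trans (by simp [v, a])).symm
  have hcoeff : (fun k : Fin n => ((vecPoly a).map GaussianInt.toComplex).coeff k) = v := by
    funext k
    rw [coeff_map, vecPoly_coeff]
  refine ⟨vecPoly a, vecPoly_ne_zero ha0, ?_⟩
  rw [noisePower_eq_sum_sq hH hB (lt_of_le_of_lt natDegree_map_le (natDegree_vecPoly_lt hn a)),
    hcoeff]
  rw [hv, LinearMap.toMatrix_mulVec_repr, Fintype.sum_sigma] at hx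
  have hsum : ∑ i, ‖B.mulVec v i‖ ^ 2 = ∑ i, ∑ j, (b.repr (L v) ⟨i, j⟩) ^ 2 := by
    refine Finset.sum_congr rfl fun i _ => ?_
    rw [Fin.sum_univ_two, hb0, hb1, ← Complex.normSq_eq_norm_sq, Complex.normSq_apply]
    simp only [L, LinearMap.restrictScalars_apply, Matrix.toLin'_apply]
    ring
  rw [hsum]
  refine hx.trans_eq ?_
  have hcard : Fintype.card (Σ _ : Fin n, Fin 2) = 2 * n := by
    simp [Fintype.card_sigma, mul_comm]
  rw [hcard, hM, ← hdB, etaReal, etaComplex]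
  have hn0 : (0 : ℝ) < n := by exact_mod_cast hn
  congr 1
  · push_cast
    congr 2
    · ring
    · ring
  · rw [← Real.rpow_natCast, ← Real.rpow_mul (norm_nonneg _)]
    congr 1
    push_cast
    field_simp

/-- For a real channel `|H|` is invariant under `ω ↦ -ω`. -/
theorem gramMatrix_real {H : ℂ[X]} (hconj : ∀ z : ℂ, conj (H.eval z) = H.eval (conj z)) (n : ℕ)
    (i j : Fin n) : conj (gramMatrix n H i j) = gramMatrix n H i j := by
  simp only [gramMatrix, Matrix.of_apply, weightedInner]
  rw [conj_circleAverage, ← Real.circleAverage_zero_one_congr_inv]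
  refine Real.circleAverage_congr_sphere fun z hz => ?_
  have hz1 : ‖z‖ = 1 := by simpa using hz
  simp only [← conj_eq_inv hz1, ← hconj, Complex.norm_conj, eval_pow, eval_X, map_div₀, map_mul,
    map_pow, Complex.conj_conj, Complex.conj_ofReal]

theorem exists_int_filter {H : ℂ[X]} (hH : ∀ z : ℂ, ‖z‖ = 1 → H.eval z ≠ 0)
    (hconj : ∀ z : ℂ, conj (H.eval z) = H.eval (conj z)) {n : ℕ}
    (hn : 0 < n) (hdet : (gramMatrix n H).det ≠ 0) :
    ∃ J : ℤ[X], J ≠ 0 ∧ noisePower (J.map (Int.castRingHom ℂ)) H ≤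
      etaReal n * ‖(gramMatrix n H).det‖ ^ (1 / (n : ℝ)) := by
  have : Nonempty (Fin n) := ⟨⟨0, hn⟩⟩
  let A : Matrix (Fin n) (Fin n) ℝ := (gramMatrix n H).map Complex.re
  have hA : gramMatrix n H = A.map ((↑) : ℝ → ℂ) := by
    ext i j
    exact (Complex.conj_eq_iff_re.1 (gramMatrix_real hconj n i j)).symm
  have hApos : A.PosSemidef := by
    refine Matrix.PosSemidef.of_dotProduct_mulVec_nonneg ?_ fun x => ?_
    · ext i j
      have := congrArg Complex.re (congrFun (congrFun (gramMatrix_isHermitian n H) i) j)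
      simpa [A] using this
    · have h := star_dotProduct_gramMatrix_mulVec hH hn (fun i => (x i : ℂ))
      have h2 : dotProduct (star fun i => (x i : ℂ)) ((gramMatrix n H).mulVec fun i => (x i : ℂ)) =
          ((dotProduct (star x) (A.mulVec x) : ℝ) : ℂ) := by
        rw [hA]
        simp [dotProduct, Matrix.mulVec]
      rw [h2, Complex.ofReal_inj] at h
      rw [h]
      exact noisePower_nonneg _ _
  obtain ⟨B, hB⟩ := exists_conjTranspose_mul_self hApos
  have hBC : gramMatrix n H = (B.map ((↑) : ℝ → ℂ)).conjTranspose * B.map ((↑) : ℝ → ℂ) := by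
    rw [hA, hB]
    ext i j
    simp [Matrix.mul_apply]
  have hdB : ‖(gramMatrix n H).det‖ = B.det ^ 2 := by
    have h1 : (B.map ((↑) : ℝ → ℂ)).det = (B.det : ℂ) :=
      (RingHom.map_det Complex.ofRealHom B).symm
    rw [hBC, Matrix.det_mul, Matrix.det_conjTranspose, norm_mul, norm_star, h1, ← sq,
      Complex.norm_real, Real.norm_eq_abs, sq_abs]
  have hB0 : B.det ≠ 0 := by
    intro h
    rw [h] at hdB
    exact hdet (norm_eq_zero.1 (by simpa using hdB))
  obtain ⟨x, hx0, hx⟩ := exists_int_ne_zero_sum_sq_le B hB0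
  refine ⟨vecPoly x, vecPoly_ne_zero hx0, ?_⟩
  rw [noisePower_eq_sum_sq hH hBC (lt_of_le_of_lt natDegree_map_le (natDegree_vecPoly_lt hn x))]
  rw [Fintype.card_fin, ← hdB] at hx
  refine Eq.trans_le (Finset.sum_congr rfl fun i _ => ?_) hx
  have : (B.map ((↑) : ℝ → ℂ)).mulVec
      (fun k : Fin n => ((vecPoly x).map (Int.castRingHom ℂ)).coeff k) i =
      ((B.mulVec (fun i => (x i : ℝ)) i : ℝ) : ℂ) := by
    simp [Matrix.mulVec, dotProduct, vecPoly_coeff]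
  rw [this, Complex.norm_real, Real.norm_eq_abs, sq_abs]

/-! ### Existence of an optimal filter -/

theorem noisePower_one {f : ℂ[X]} {n : ℕ} (hf : f.natDegree < n) :
    noisePower f 1 = ∑ k : Fin n, ‖f.coeff k‖ ^ 2 := by
  rw [noisePower_eq_sum_sq (B := 1) (fun z _ => by simp) (by simp [gramMatrix_one]) hf]
  simp

/-- The noise power dominates the energy of the coefficients, as `|H|` is bounded on the circle. -/
theorem exists_pos_mul_sum_sq_le {H : ℂ[X]} (hH : ∀ z : ℂ, ‖z‖ = 1 → H.eval z ≠ 0) :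
    ∃ c : ℝ, 0 < c ∧ ∀ (f : ℂ[X]) (n : ℕ), f.natDegree < n →
      c * ∑ k : Fin n, ‖f.coeff k‖ ^ 2 ≤ noisePower f H := by
  obtain ⟨M, hM⟩ := (isCompact_sphere (0 : ℂ) 1).exists_bound_of_continuousOn
    (f := fun z => H.eval z) H.continuous.continuousOn
  have hM0 : 0 < M := (norm_pos_iff.2 (hH 1 (by simp))).trans_le (hM 1 (by simp))
  refine ⟨(M ^ 2)⁻¹, by positivity, fun f n hf => ?_⟩
  rw [← noisePower_one hf, noisePower_eq_circleAverage, noisePower_eq_circleAverage,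
    ← smul_eq_mul, ← Real.circleAverage_fun_smul]
  refine Real.circleAverage_mono ?_ ?_ ?_
  · refine ContinuousOn.circleIntegrable' ?_
    simp only [eval_one, norm_one, one_pow, div_one]
    fun_prop
  · refine ContinuousOn.circleIntegrable' ?_
    refine ContinuousOn.div (by fun_prop) (by fun_prop) fun z hz => ?_
    have : ‖z‖ = 1 := by simpa using hz
    simpa using hH z this
  · intro z hz
    have hz1 : ‖z‖ = 1 := by simpa using hz
    have h1 : 0 < ‖H.eval z‖ := norm_pos_iff.2 (hH z hz1)
    have h2 : ‖H.eval z‖ ≤ M := hM z (by simpa using hz1)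
    simp only [eval_one, norm_one, one_pow, div_one, smul_eq_mul]
    rw [inv_mul_eq_div]
    gcongr

theorem noisePower_X_pow_mul (f H : ℂ[X]) (k : ℕ) :
    noisePower (X ^ k * f) H = noisePower f H := by
  simp [noisePower, norm_expj]

theorem weightedInner_X_pow_add (H : ℂ[X]) (i k : ℕ) :
    weightedInner H (X ^ i) (X ^ (i + k)) = weightedInner H 1 (X ^ k) := by
  refine weightedInner_congr fun z hz => ?_
  have hz0 : z ≠ 0 := by rintro rfl; simp at hz
  have h1 : (z ^ i)⁻¹ * (z ^ i * z ^ k) = z ^ k := inv_mul_cancel_left₀ (pow_ne_zero _ hz0) _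
  simp only [eval_pow, eval_X, eval_one, map_pow, map_one, conj_eq_inv hz, inv_pow, one_mul,
    pow_add, eval_mul, h1]

/-- The Riemann–Lebesgue lemma for the autocorrelation of the noise. -/
theorem tendsto_weightedInner_one_X_pow (H : ℂ[X]) :
    Tendsto (fun k : ℕ => weightedInner H 1 (X ^ k)) atTop (𝓝 0) := by
  let g : ℝ → ℂ := (Set.Ioc (-Real.pi) Real.pi).indicator
    fun ω => 1 / ((‖H.eval (expj ω)‖ ^ 2 : ℝ) : ℂ)
  have h1 := Real.tendsto_integral_exp_smul_cocompact g
  have h2 : Tendsto (fun k : ℕ => -((k : ℝ) / (2 * Real.pi))) atTop (cocompact ℝ) := by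
    refine Tendsto.mono_right ?_ atBot_le_cocompact
    refine tendsto_neg_atTop_atBot.comp ?_
    exact tendsto_natCast_atTop_atTop.atTop_div_const (by positivity)
  have h3 := (h1.comp h2).const_smul (1 / (2 * Real.pi))
  rw [smul_zero] at h3
  refine h3.congr fun k => ?_
  rw [weightedInner, circleAverage_expj]
  congr 1
  rw [intervalIntegral.integral_of_le (by linarith [Real.pi_pos]),
    ← MeasureTheory.integral_indicator measurableSet_Ioc]
  simp only [Function.comp]
  congr 1
  funext ω
  by_cases hω : ω ∈ Set.Ioc (-Real.pi) Real.pi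
  · simp only [g, Set.indicator_of_mem hω]
    rw [Circle.smul_def, Real.fourierChar_apply, smul_eq_mul, eval_one, map_one, one_mul,
      eval_pow, eval_X, expj, ← Complex.exp_nat_mul]
    rw [mul_one_div]
    congr 2
    have := Real.pi_pos.ne'
    push_cast
    have : (Real.pi : ℂ) ≠ 0 := by exact_mod_cast this
    field_simp
  · simp only [g, Set.indicator_of_notMem hω, smul_zero]

theorem noisePower_add {H : ℂ[X]} (hH : ∀ z : ℂ, ‖z‖ = 1 → H.eval z ≠ 0) (f g : ℂ[X]) :
    noisePower (f + g) H = noisePower f H + noisePower g H + 2 * (weightedInner H f g).re := by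
  have h := weightedInner_self (f + g) H
  rw [weightedInner_add_left hH, weightedInner_add_right hH, weightedInner_add_right hH,
    weightedInner_self, weightedInner_self, ← weightedInner_conj H f g] at h
  have h2 := congrArg Complex.re h
  simp at h2
  linarith

/-- Two filters separated by a gap of length `N` are nearly orthogonal if the autocorrelation is
small from lag `N` on. -/
theorem norm_weightedInner_le_of_gap {H : ℂ[X]} (hH : ∀ z : ℂ, ‖z‖ = 1 → H.eval z ≠ 0) {N t n : ℕ}
    {ε : ℝ} (hr : ∀ k, N ≤ k → ‖weightedInner H 1 (X ^ k)‖ ≤ ε) {f g : ℂ[X]}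
    (hf : f.natDegree < n) (hg : g.natDegree < n)
    (hft : ∀ k, t ≤ k → f.coeff k = 0) (hgt : ∀ k, k < t + N → g.coeff k = 0) :
    ‖weightedInner H f g‖ ≤ ε * ((∑ k : Fin n, ‖f.coeff k‖) * ∑ k : Fin n, ‖g.coeff k‖) := by
  rw [weightedInner_eq_sum hH hf hg, Finset.sum_mul_sum, Finset.mul_sum]
  refine (norm_sum_le _ _).trans (Finset.sum_le_sum fun i _ => ?_)
  rw [Finset.mul_sum]
  refine (norm_sum_le _ _).trans (Finset.sum_le_sum fun j _ => ?_)
  rw [norm_mul, norm_mul, Complex.norm_conj]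
  by_cases hi : t ≤ (i : ℕ)
  · simp [hft _ hi]
  by_cases hj : (j : ℕ) < t + N
  · simp [hgt _ hj]
  have hG : ‖gramMatrix n H i j‖ ≤ ε := by
    obtain ⟨k, hk⟩ := Nat.exists_eq_add_of_le (show (i : ℕ) ≤ j by omega)
    simp only [gramMatrix, Matrix.of_apply]
    rw [hk, weightedInner_X_pow_add]
    exact hr k (by omega)
  calc ‖f.coeff i‖ * ‖gramMatrix n H i j‖ * ‖g.coeff j‖
      ≤ ‖f.coeff i‖ * ε * ‖g.coeff j‖ := by gcongr
    _ = _ := by ring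

/-- The part of degree less than `t` of a polynomial. -/
noncomputable def lowPart {R : Type*} [Semiring R] (t : ℕ) (f : R[X]) : R[X] :=
  ∑ i ∈ Finset.range t, C (f.coeff i) * X ^ i

theorem lowPart_coeff {R : Type*} [Semiring R] (t : ℕ) (f : R[X]) (k : ℕ) :
    (lowPart t f).coeff k = if k < t then f.coeff k else 0 := by
  simp [lowPart, coeff_X_pow]

/-- A polynomial of large degree with few nonzero coefficients has a long gap: one of the blocks of
length `N` below degree `N · #support` contains no exponent of the support. -/
theorem exists_gap {R : Type*} [Semiring R] {f : R[X]} (h0 : f.coeff 0 ≠ 0) {N : ℕ} (hN : 0 < N)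
    (hdeg : N * f.support.card ≤ f.natDegree) :
    ∃ t, 0 < t ∧ t ≤ f.natDegree ∧ ∀ k, t ≤ k → k < t + N → f.coeff k = 0 := by
  have hf : f ≠ 0 := by rintro rfl; simp at h0
  have h0s : 0 ∈ f.support := mem_support_iff.2 h0
  have hm : 0 < f.support.card := Finset.card_pos.2 ⟨0, h0s⟩
  have hd : f.natDegree ∈ f.support := natDegree_mem_support_of_nonzero hf
  have hcard : ((f.support.erase f.natDegree).image (· / N)).card <
      (Finset.range f.support.card).card := by
    rw [Finset.card_range]
    refine Finset.card_image_le.trans_lt ?_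
    rw [Finset.card_erase_of_mem hd]
    omega
  obtain ⟨j, hj, hj'⟩ := Finset.exists_mem_notMem_of_card_lt_card hcard
  rw [Finset.mem_range] at hj
  have hlt : N * (j + 1) ≤ N * f.support.card := Nat.mul_le_mul_left _ hj
  have hsucc : N * (j + 1) = N * j + N := by ring
  have key : ∀ k, N * j ≤ k → k < N * j + N → f.coeff k = 0 := by
    intro k hk1 hk2
    by_contra hk
    refine hj' (Finset.mem_image.2 ⟨k, Finset.mem_erase.2 ⟨by omega, mem_support_iff.2 hk⟩, ?_⟩)
    refine Nat.div_eq_of_lt_le ?_ ?_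
    · rwa [mul_comm]
    · rw [mul_comm]; omega
  refine ⟨N * j, ?_, by omega, key⟩
  rcases Nat.eq_zero_or_pos j with rfl | hj0
  · exact absurd (key 0 (by simp) (by omega)) h0
  · positivity

/-- Let `q > 0` be the infimum of the noise powers. A filter of power below `3q/2` has bounded
coefficients, few of them nonzero, and no long gap: otherwise it would split into two nearly
orthogonal nonzero filters, with a power close to `2q`. Up to delay, which does not change the
power, only finitely many such filters exist. -/
theorem exists_isOptimalFilter {R : Type} [CommRing R] (φ : R →+* ℂ)
    (hφ : ∀ a, a ≠ 0 → 1 ≤ ‖φ a‖) (hfin : ∀ B : ℝ, {a | ‖φ a‖ ≤ B}.Finite) {H : ℂ[X]}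
    (hH : ∀ z : ℂ, ‖z‖ = 1 → H.eval z ≠ 0) : ∃ I : R[X], IsOptimalFilter φ H I := by
  have : Nontrivial R := φ.domain_nontrivial
  obtain ⟨c, hc, hcoer⟩ := exists_pos_mul_sum_sq_le hH
  -- The noise power dominates the energy of the coefficients.
  have henergy (J : R[X]) : c * ∑ k : Fin (J.natDegree + 1), ‖φ (J.coeff k)‖ ^ 2 ≤
      noisePower (J.map φ) H := by
    simpa using hcoer (J.map φ) (J.natDegree + 1) (Nat.lt_succ_of_le natDegree_map_le)
  have hlower (J : R[X]) (hJ : J ≠ 0) : c ≤ noisePower (J.map φ) H := by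
    refine le_trans ?_ (henergy J)
    refine le_mul_of_one_le_right hc.le ?_
    have h1 := hφ J.leadingCoeff (by simpa using hJ)
    refine le_trans ?_ (Finset.single_le_sum (f := fun k : Fin (J.natDegree + 1) =>
      ‖φ (J.coeff k)‖ ^ 2) (fun _ _ => by positivity) (Finset.mem_univ (Fin.last _)))
    exact one_le_pow₀ h1
  let S : Set ℝ := (fun J : R[X] => noisePower (J.map φ) H) '' {J | J ≠ 0}
  have hSne : S.Nonempty := ⟨_, 1, one_ne_zero, rfl⟩
  have hSbdd : BddBelow S := ⟨c, by rintro _ ⟨J, hJ, rfl⟩; exact hlower J hJ⟩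
  let q := sInf S
  have hq : 0 < q := hc.trans_le (le_csInf hSne (by rintro _ ⟨J, hJ, rfl⟩; exact hlower J hJ))
  have hqle (J : R[X]) (hJ : J ≠ 0) : q ≤ noisePower (J.map φ) H := csInf_le hSbdd ⟨J, hJ, rfl⟩
  let T := 2 * q / c
  have hT : 0 < T := by positivity
  have hsumT (J : R[X]) (hJ : noisePower (J.map φ) H < 3 / 2 * q) :
      ∑ k : Fin (J.natDegree + 1), ‖φ (J.coeff k)‖ ^ 2 ≤ T := by
    rw [le_div_iff₀ hc]
    linarith [henergy J]
  -- With this bound on the autocorrelation the cross term of two filters of energy at most `T`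
  -- is at most `q / 4`, since `‖a‖ ≤ ‖a‖²` for the coefficients.
  let ε := q / (4 * (T ^ 2 + 1))
  have hε : 0 < ε := by positivity
  obtain ⟨N₀, hN₀⟩ := Filter.eventually_atTop.1
    ((tendsto_weightedInner_one_X_pow H).norm.eventually
      (ge_mem_nhds (a := ε) (by simpa using hε)))
  let N := N₀ + 1
  have hN (k : ℕ) (hk : N ≤ k) : ‖weightedInner H 1 (X ^ k)‖ ≤ ε := hN₀ k (by omega)
  have hle_sq (a : R) : ‖φ a‖ ≤ ‖φ a‖ ^ 2 := by
    by_cases ha : a = 0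
    · simp [ha]
    · nlinarith [hφ a ha]
  have hcard (J : R[X]) (hJ : noisePower (J.map φ) H < 3 / 2 * q) : (J.support.card : ℝ) ≤ T := by
    refine le_trans ?_ (hsumT J hJ)
    rw [Fin.sum_univ_eq_sum_range (fun k => ‖φ (J.coeff k)‖ ^ 2)]
    refine le_trans ?_ (Finset.sum_le_sum_of_subset_of_nonneg (s := J.support) ?_
      fun _ _ _ => by positivity)
    · rw [Finset.card_eq_sum_ones]
      push_cast
      exact Finset.sum_le_sum fun k hk => one_le_pow₀ (hφ _ (mem_support_iff.1 hk))
    · intro k hk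
      exact Finset.mem_range.2 (Nat.lt_succ_of_le (le_natDegree_of_mem_supp k hk))
  -- A filter with a long gap costs almost as much as two filters.
  have hdeg (J : R[X]) (h0 : J.coeff 0 ≠ 0) (hJ : noisePower (J.map φ) H < 3 / 2 * q) :
      J.natDegree < N * (⌊T⌋₊ + 1) := by
    by_contra! hcon
    have hle : N * J.support.card ≤ J.natDegree := by
      refine le_trans (Nat.mul_le_mul_left _ ?_) hcon
      exact (Nat.le_floor (hcard J hJ)).trans (Nat.le_succ _)
    obtain ⟨t, ht0, htd, hgap⟩ := exists_gap h0 (by omega : 0 < N) hle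
    let J₁ := lowPart t J
    let J₂ := J - J₁
    have hc1 (k : ℕ) : J₁.coeff k = if k < t then J.coeff k else 0 := lowPart_coeff t J k
    have hc2 (k : ℕ) : J₂.coeff k = if k < t then 0 else J.coeff k := by
      simp only [J₂, coeff_sub, hc1]
      split_ifs <;> simp
    have hJ0 : J ≠ 0 := by rintro rfl; simp at h0
    have hJ1 : J₁ ≠ 0 := fun h => by
      have := hc1 0
      rw [h, if_pos ht0] at this
      exact h0 (by simpa using this.symm)
    have hJ2 : J₂ ≠ 0 := fun h => by
      have := hc2 J.natDegree
      rw [h, if_neg (by omega)] at this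
      exact hJ0 (leadingCoeff_eq_zero.1 (by simpa using this.symm))
    have hd1 : J₁.natDegree < J.natDegree + 1 := by
      refine Nat.lt_succ_of_le (natDegree_le_iff_coeff_eq_zero.2 fun k hk => ?_)
      rw [hc1, coeff_eq_zero_of_natDegree_lt hk]
      simp
    have hd2 : J₂.natDegree < J.natDegree + 1 := by
      refine Nat.lt_succ_of_le (natDegree_le_iff_coeff_eq_zero.2 fun k hk => ?_)
      rw [hc2, coeff_eq_zero_of_natDegree_lt hk]
      simp
    have hcross := norm_weightedInner_le_of_gap hH hN
      (f := J₁.map φ) (g := J₂.map φ) (t := t) (n := J.natDegree + 1)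
      (natDegree_map_le.trans_lt hd1) (natDegree_map_le.trans_lt hd2)
      (fun k hk => by rw [coeff_map, hc1, if_neg (by omega), map_zero])
      (fun k hk => by
        rw [coeff_map, hc2]
        split_ifs with h
        · exact map_zero φ
        · rw [hgap k (by omega) hk, map_zero])
    have hs1 : ∑ k : Fin (J.natDegree + 1), ‖(J₁.map φ).coeff k‖ ≤ T := by
      refine le_trans (Finset.sum_le_sum fun k _ => ?_) (hsumT J hJ)
      rw [coeff_map, hc1]
      split_ifs
      · exact hle_sq _
      · rw [map_zero, norm_zero]; positivity
    have hs2 : ∑ k : Fin (J.natDegree + 1), ‖(J₂.map φ).coeff k‖ ≤ T := by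
      refine le_trans (Finset.sum_le_sum fun k _ => ?_) (hsumT J hJ)
      rw [coeff_map, hc2]
      split_ifs
      · rw [map_zero, norm_zero]; positivity
      · exact hle_sq _
    have hcross2 : ‖weightedInner H (J₁.map φ) (J₂.map φ)‖ ≤ q / 4 := by
      refine hcross.trans ?_
      calc ε * ((∑ k : Fin (J.natDegree + 1), ‖(J₁.map φ).coeff k‖) *
            ∑ k : Fin (J.natDegree + 1), ‖(J₂.map φ).coeff k‖)
          ≤ ε * (T * T) := by gcongr
        _ ≤ ε * (T ^ 2 + 1) := by gcongr; nlinarith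
        _ = q / 4 := by simp only [ε]; field_simp
    have hadd := noisePower_add hH (J₁.map φ) (J₂.map φ)
    rw [← Polynomial.map_add, show J₁ + J₂ = J by simp [J₂]] at hadd
    have h1 := hqle J₁ hJ1
    have h2 := hqle J₂ hJ2
    have h3 := (abs_le.1 (Complex.abs_re_le_norm (weightedInner H (J₁.map φ) (J₂.map φ)))).1
    linarith
  -- Up to a delay, only finitely many filters remain.
  let L := N * (⌊T⌋₊ + 1)
  let F : Set R[X] := {J | J ≠ 0 ∧ J.natDegree < L ∧ ∀ k, ‖φ (J.coeff k)‖ ≤ T}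
  have hFfin : F.Finite := by
    have h1 : (Set.univ.pi fun _ : Fin L => {a : R | ‖φ a‖ ≤ T}).Finite :=
      Set.Finite.pi fun _ => hfin T
    refine Set.Finite.of_finite_image (f := fun (J : R[X]) (k : Fin L) => J.coeff k)
      (h1.subset ?_) ?_
    · rintro _ ⟨J, hJ, rfl⟩ k _
      exact hJ.2.2 k
    · intro J hJ J' hJ' h
      ext k
      by_cases hk : k < L
      · exact congrFun h ⟨k, hk⟩
      · rw [coeff_eq_zero_of_natDegree_lt (hJ.2.1.trans_le (by omega)),
          coeff_eq_zero_of_natDegree_lt (hJ'.2.1.trans_le (by omega))]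
  have hred (J : R[X]) (hJ0 : J ≠ 0) (hJ : noisePower (J.map φ) H < 3 / 2 * q) :
      ∃ J' ∈ F, noisePower (J'.map φ) H = noisePower (J.map φ) H := by
    obtain ⟨J', hJJ', hX⟩ := exists_eq_pow_rootMultiplicity_mul_and_not_dvd J hJ0 0
    rw [C_0, sub_zero] at hJJ' hX
    have heq : noisePower (J'.map φ) H = noisePower (J.map φ) H := by
      conv_rhs => rw [hJJ', Polynomial.map_mul, Polynomial.map_pow, map_X, noisePower_X_pow_mul]
    have h0 : J'.coeff 0 ≠ 0 := fun h => hX (X_dvd_iff.2 h)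
    refine ⟨J', ⟨?_, hdeg J' h0 (heq ▸ hJ), fun k => ?_⟩, heq⟩
    · rintro rfl; simp at h0
    · by_cases hk : k < J'.natDegree + 1
      · exact (hle_sq _).trans ((Finset.single_le_sum (f := fun k : Fin (J'.natDegree + 1) =>
          ‖φ (J'.coeff k)‖ ^ 2) (fun _ _ => by positivity) (Finset.mem_univ ⟨k, hk⟩)).trans
          (hsumT J' (heq ▸ hJ)))
      · rw [coeff_eq_zero_of_natDegree_lt (by omega), map_zero, norm_zero]
        exact hT.le
  obtain ⟨_, ⟨J₀, hJ₀, rfl⟩, hJ₀q⟩ := exists_lt_of_csInf_lt hSne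
    (show sInf S < 3 / 2 * q by change q < _; linarith)
  obtain ⟨J₁, hJ₁F, hJ₁⟩ := hred J₀ hJ₀ hJ₀q
  obtain ⟨I, hIF, hI⟩ := Set.exists_min_image F (fun J => noisePower (J.map φ) H) hFfin ⟨J₁, hJ₁F⟩
  refine ⟨I, hIF.1, fun J hJ => ?_⟩
  rcases lt_or_ge (noisePower (J.map φ) H) (3 / 2 * q) with h | h
  · obtain ⟨J', hJ'F, hJ'⟩ := hred J hJ h
    exact hJ' ▸ hI J' hJ'F
  · exact ((hI J₁ hJ₁F).trans (hJ₁.trans_lt hJ₀q).le).trans h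

/-! ### The bound for the optimal filter -/

theorem min_one_le_rpow_one_div {a : ℝ} (ha : 0 < a) {n : ℕ} (hn : 0 < n) :
    min 1 a ≤ a ^ (1 / (n : ℝ)) := by
  have hn1 : (1 : ℝ) ≤ n := by exact_mod_cast hn
  rcases le_total 1 a with h | h
  · exact (min_le_left _ _).trans (Real.one_le_rpow h (by positivity))
  · refine (min_le_right _ _).trans ?_
    conv_lhs => rw [← Real.rpow_one a]
    exact Real.rpow_le_rpow_of_exponent_ge ha h ((div_le_one (by positivity)).2 hn1)

theorem exists_isLeast_image_Ici {f : ℕ → ℝ} (hf : Tendsto f atTop atTop) (k : ℕ) :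
    ∃ n, k ≤ n ∧ IsLeast (f '' Set.Ici k) (f n) := by
  obtain ⟨n, hn, h⟩ := Filter.Tendsto.exists_within_forall_le (s := Set.Ici k) ⟨k, le_refl k⟩
    (f := f) (by rwa [Nat.cofinite_eq_atTop])
  exact ⟨n, hn, ⟨n, hn, rfl⟩, by rintro _ ⟨m, hm, rfl⟩; exact h m hm⟩

theorem tendsto_linear_mul_atTop {c a : ℝ} (hc : 0 < c) (ha : 0 < a) {g : ℕ → ℝ}
    (hg : ∀ n, 0 < n → c * n ≤ g n) :
    Tendsto (fun n : ℕ => g n * a ^ (1 / (n : ℝ))) atTop atTop := by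
  have hm : 0 < min 1 a := lt_min one_pos ha
  refine tendsto_atTop_mono' atTop ?_
    (tendsto_natCast_atTop_atTop.const_mul_atTop (mul_pos hc hm))
  filter_upwards [eventually_gt_atTop 0] with n hn
  calc c * min 1 a * n = c * n * min 1 a := by ring
    _ ≤ g n * a ^ (1 / (n : ℝ)) :=
      mul_le_mul (hg n hn) (min_one_le_rpow_one_div ha hn) hm.le
        ((by positivity : 0 ≤ c * n).trans (hg n hn))

theorem linear_le_etaReal {n : ℕ} (hn : 0 < n) :
    2 / (Real.pi * Real.exp 1) * n ≤ etaReal n := by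
  have hn1 : (1 : ℝ) ≤ n := by exact_mod_cast hn
  have hpi := Real.pi_gt_three
  rw [etaReal, div_mul_eq_mul_div]
  refine le_mul_of_one_le_right (by positivity) (Real.one_le_rpow ?_ (by positivity))
  nlinarith

theorem linear_le_etaComplex {n : ℕ} (hn : 0 < n) :
    4 / (Real.pi * Real.exp 1) * n ≤ etaComplex n := by
  have hn1 : (1 : ℝ) ≤ n := by exact_mod_cast hn
  have hpi := Real.pi_gt_three
  rw [etaComplex, div_mul_eq_mul_div]
  refine le_mul_of_one_le_right (by positivity) (Real.one_le_rpow ?_ (by positivity))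
  nlinarith

/-- The common end of the real and the complex case: filters `J` of length `n` that satisfy the
bound with the Toeplitz determinant, for every `n`, yield the bound for the optimal filter. -/
theorem noise_bound_of_filters {R : Type} [CommRing R] {φ : R →+* ℂ}
    (hφ : ∀ a, a ≠ 0 → 1 ≤ ‖φ a‖) (hfin : ∀ B : ℝ, {a | ‖φ a‖ ≤ B}.Finite)
    {p : ℕ} {h : Fin (p + 1) → ℂ} (hH : ∀ z : ℂ, ‖z‖ = 1 → (channel h).eval z ≠ 0)
    {η : ℕ → ℝ} {c : ℝ} (hc : 0 < c) (hη : ∀ n, 0 < n → c * n ≤ η n)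
    (hJ : ∀ n, 0 < n → (gramMatrix n (channel h)).det ≠ 0 → ∃ J : R[X], J ≠ 0 ∧
      noisePower (J.map φ) (channel h) ≤ η n * ‖(gramMatrix n (channel h)).det‖ ^ (1 / (n : ℝ))) :
    (∃ I : R[X], IsOptimalFilter φ (channel h) I) ∧
      ∃ m : ℝ, IsLeast ((fun n : ℕ => η n * alpha h ^ (1 / (n : ℝ))) '' Set.Ici (p + 1)) m ∧
        ∀ I : R[X], IsOptimalFilter φ (channel h) I →
          noisePower (I.map φ) (channel h) ≤ dfeNoisePower (channel h) * m := by
  refine ⟨exists_isOptimalFilter φ hφ hfin hH, ?_⟩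
  have hα := (alpha_pos_and_det_bound h hH le_rfl).1
  obtain ⟨n, hn, hleast⟩ := exists_isLeast_image_Ici (tendsto_linear_mul_atTop hc hα hη) (p + 1)
  refine ⟨_, hleast, fun I hI => ?_⟩
  obtain ⟨_, hd0, hd⟩ := alpha_pos_and_det_bound h hH hn
  have hn0 : 0 < n := by omega
  obtain ⟨J, hJ0, hJ⟩ := hJ n hn0 (norm_pos_iff.1 hd0)
  have hη0 : 0 ≤ η n := (by positivity : 0 ≤ c * n).trans (hη n hn0)
  calc noisePower (I.map φ) (channel h) ≤ noisePower (J.map φ) (channel h) := hI.2 J hJ0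
    _ ≤ η n * ‖(gramMatrix n (channel h)).det‖ ^ (1 / (n : ℝ)) := hJ
    _ ≤ η n * (dfeNoisePower (channel h) * alpha h ^ (1 / (n : ℝ))) :=
      mul_le_mul_of_nonneg_left
        (rpow_bound hn0 (norm_nonneg _) (Real.exp_pos _).le hα.le hd) hη0
    _ = _ := by ring

theorem one_le_norm_intCast {a : ℤ} (ha : a ≠ 0) : 1 ≤ ‖Int.castRingHom ℂ a‖ := by
  rw [eq_intCast, Complex.norm_intCast]
  exact_mod_cast Int.one_le_abs ha

theorem finite_norm_intCast_le (B : ℝ) : {a : ℤ | ‖Int.castRingHom ℂ a‖ ≤ B}.Finite := by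
  refine (Set.finite_Icc (-⌊B⌋) ⌊B⌋).subset fun a ha => ?_
  have ha : ‖Int.castRingHom ℂ a‖ ≤ B := ha
  rw [eq_intCast, Complex.norm_intCast, ← Int.cast_abs] at ha
  exact abs_le.1 (Int.le_floor.2 ha)

theorem one_le_norm_toComplex {a : GaussianInt} (ha : a ≠ 0) :
    1 ≤ ‖GaussianInt.toComplex a‖ := by
  have h1 := GaussianInt.norm_pos.2 ha
  have h2 : (1 : ℝ) ≤ ((Zsqrtd.norm a : ℤ) : ℝ) := by exact_mod_cast h1
  rw [GaussianInt.intCast_real_norm, Complex.normSq_eq_norm_sq] at h2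
  exact (one_le_sq_iff₀ (norm_nonneg _)).1 h2

theorem finite_norm_toComplex_le (B : ℝ) :
    {a : GaussianInt | ‖GaussianInt.toComplex a‖ ≤ B}.Finite := by
  have h1 := (finite_norm_intCast_le B).prod (finite_norm_intCast_le B)
  refine Set.Finite.of_finite_image (f := fun a : GaussianInt => (a.re, a.im))
    (h1.subset ?_) ?_
  · rintro _ ⟨a, ha, rfl⟩
    have ha : ‖GaussianInt.toComplex a‖ ≤ B := ha
    have hre := Complex.abs_re_le_norm (GaussianInt.toComplex a)
    have him := Complex.abs_im_le_norm (GaussianInt.toComplex a)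
    rw [show (GaussianInt.toComplex a).re = a.re from GaussianInt.re_toComplex a.re a.im] at hre
    rw [show (GaussianInt.toComplex a).im = a.im from GaussianInt.im_toComplex a.re a.im] at him
    refine ⟨?_, ?_⟩
    · change ‖Int.castRingHom ℂ a.re‖ ≤ B
      rw [eq_intCast, Complex.norm_intCast]; exact hre.trans ha
    · change ‖Int.castRingHom ℂ a.im‖ ≤ B
      rw [eq_intCast, Complex.norm_intCast]; exact him.trans ha
  · intro a _ b _ hab
    have hab := Prod.mk.inj hab
    exact Zsqrtd.ext hab.1 hab.2

theorem conj_channel_ofReal_eval {p : ℕ} (h : Fin (p + 1) → ℝ) (z : ℂ) :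
    conj ((channel fun k => (h k : ℂ)).eval z) = (channel fun k => (h k : ℂ)).eval (conj z) := by
  simp [channel, eval_finsetSum]

end IFEqualization

theorem theorem1 (p : ℕ) :
    -- real channels, real integer filters
    (∀ h : Fin (p + 1) → ℝ,
      (∀ z : ℂ, ‖z‖ = 1 →
        (IFEqualization.channel fun k => (h k : ℂ)).eval z ≠ 0) →
      (∃ I : ℤ[X], IFEqualization.IsOptimalFilter (Int.castRingHom ℂ)
        (IFEqualization.channel fun k => (h k : ℂ)) I) ∧
      ∃ m : ℝ,
        IsLeast ((fun n : ℕ => IFEqualization.etaReal n *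
          IFEqualization.alpha (fun k => (h k : ℂ)) ^ (1 / (n : ℝ))) '' Set.Ici (p + 1)) m ∧
        ∀ I : ℤ[X],
          IFEqualization.IsOptimalFilter (Int.castRingHom ℂ)
            (IFEqualization.channel fun k => (h k : ℂ)) I →
          IFEqualization.noisePower (I.map (Int.castRingHom ℂ))
              (IFEqualization.channel fun k => (h k : ℂ)) ≤
            IFEqualization.dfeNoisePower (IFEqualization.channel fun k => (h k : ℂ)) * m) ∧
    -- complex channels, Gaussian integer filters
    (∀ h : Fin (p + 1) → ℂ,
      (∀ z : ℂ, ‖z‖ = 1 → (IFEqualization.channel h).eval z ≠ 0) →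
      (∃ I : GaussianInt[X], IFEqualization.IsOptimalFilter GaussianInt.toComplex
        (IFEqualization.channel h) I) ∧
      ∃ m : ℝ,
        IsLeast ((fun n : ℕ => IFEqualization.etaComplex n *
          IFEqualization.alpha h ^ (1 / (n : ℝ))) '' Set.Ici (p + 1)) m ∧
        ∀ I : GaussianInt[X],
          IFEqualization.IsOptimalFilter GaussianInt.toComplex (IFEqualization.channel h) I →
          IFEqualization.noisePower (I.map GaussianInt.toComplex) (IFEqualization.channel h) ≤
            IFEqualization.dfeNoisePower (IFEqualization.channel h) * m) := by
  have hpi := Real.pi_pos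
  refine ⟨fun h hH => ?_, fun h hH => ?_⟩
  · exact IFEqualization.noise_bound_of_filters
      (fun _ => IFEqualization.one_le_norm_intCast) IFEqualization.finite_norm_intCast_le hH
      (by positivity) (fun _ => IFEqualization.linear_le_etaReal) fun _ hn hdet =>
        IFEqualization.exists_int_filter hH (IFEqualization.conj_channel_ofReal_eval h) hn hdet
  · exact IFEqualization.noise_bound_of_filters
      (fun _ => IFEqualization.one_le_norm_toComplex) IFEqualization.finite_norm_toComplex_le hH
      (by positivity) (fun _ => IFEqualization.linear_le_etaComplex) fun _ hn hdet =>
        IFEqualization.exists_gaussian_filter hH hn hdet
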